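/- Let $F$ be R. Thompson's group: the group of all piecewise linear increasing homeomorphisms of $[0,1]$ with finitely many linear segments, with slopes of the form $2^n$ ($n\in\mathbb Z$) and with the endpoints of the segments being finite binary fractions $a/2^n$; the product is composition from left to right. Let $x_0,x_1\in F$ be $$x_0(t)=\begin{cases}2t,&0\le t\le\frac14\\ t+\frac14,&\frac14\le t\le\frac12\\ \frac t2+\frac12,&\frac12\le t\le1\end{cases}\qquad x_1(t)=\begin{cases}t,&0\le t\le\frac12\\ 2t-\frac12,&\frac12\le t\le\frac58\\ t+\frac18,&\frac58\le t\le\frac34\\ \frac t2+\frac12,&\frac34\le t\le1\end{cases}$$ and $x_{i+1}=x_0^{-i}x_1x_0^{i}$ for $i\ge1$. Let $\overrightarrow F=\langle x_0x_1,\,x_1x_2,\,x_2x_3\rangle$ be Jones' subgroup of $F$ and let $G=\langle x_0x_2,\,x_1x_2\rangle\le F$. Then $G$ has index $2$ in $F$, and $\overrightarrow F$ is contained in $G$ and is a maximal subgroup of infinite index in $G$. Moreover, exactly three subgroups of $F$ contain $\overrightarrow F$, namely the pairwise distinct subgroups $\overrightarrow F$, $G$ and $F$. -/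

import Mathlib

/-- The finite binary fractions `a / 2 ^ n`. -/
def IsDyadic (r : ℝ) : Prop := ∃ (a : ℤ) (n : ℕ), r = a / 2 ^ n

/-- `f` is an increasing homeomorphism of `[0,1]` which is piecewise linear with finitely many
linear segments, whose slopes are integer powers of `2` and whose endpoints are finite binary
fractions. The finite set `s` holds the breakpoints: on every interval `[a, b]` with no point of
`s` in its interior, `f` is linear with slope `2 ^ k` for some integer `k`; the endpoints
`(t, f t)` of the segments of the graph have dyadic coordinates. (An order isomorphism
of `[0,1]` is the same thing as an increasing homeomorphism of `[0,1]`.) -/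
def IsDyadicPL (f : unitInterval ≃o unitInterval) : Prop :=
  ∃ s : Finset unitInterval, (∀ t ∈ s, IsDyadic (t : ℝ) ∧ IsDyadic (f t : ℝ)) ∧
    ∀ a b : unitInterval, a < b → (∀ t ∈ s, t ∉ Set.Ioo a b) →
      ∃ k : ℤ, ∀ x ∈ Set.Icc a b, (f x : ℝ) = f a + 2 ^ k * ((x : ℝ) - a)

lemma IsDyadic.add {x y : ℝ} (hx : IsDyadic x) (hy : IsDyadic y) : IsDyadic (x + y) := by
  obtain ⟨a, m, rfl⟩ := hx
  obtain ⟨b, n, rfl⟩ := hy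
  refine ⟨a * 2 ^ n + b * 2 ^ m, m + n, ?_⟩
  push_cast
  field_simp
  ring

lemma IsDyadic.neg {x : ℝ} (hx : IsDyadic x) : IsDyadic (-x) := by
  obtain ⟨a, m, rfl⟩ := hx
  exact ⟨-a, m, by push_cast; ring⟩

lemma IsDyadic.zpow_mul {x : ℝ} (hx : IsDyadic x) (k : ℤ) : IsDyadic (2 ^ k * x) := by
  obtain ⟨a, m, rfl⟩ := hx
  obtain ⟨n, rfl | rfl⟩ := k.eq_nat_or_neg
  · exact ⟨a * 2 ^ n, m, by push_cast; rw [zpow_natCast]; ring⟩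
  · refine ⟨a, n + m, ?_⟩
    rw [zpow_neg, zpow_natCast, pow_add]
    field_simp

lemma isDyadic_zero : IsDyadic 0 := ⟨0, 0, by simp⟩

lemma isDyadic_one : IsDyadic 1 := ⟨1, 0, by simp⟩

/-- Every point lies on a linear segment that starts at a dyadic breakpoint. -/
lemma IsDyadicPL.exists_segment {f : unitInterval ≃o unitInterval} (hf : IsDyadicPL f)
    (y : unitInterval) : ∃ (a : unitInterval) (k : ℤ), IsDyadic (a : ℝ) ∧ IsDyadic (f a : ℝ) ∧
      (f y : ℝ) = f a + 2 ^ k * ((y : ℝ) - a) := by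
  obtain ⟨s, hs, h⟩ := hf
  classical
  by_cases hy : y = 0
  · subst hy
    refine ⟨0, 0, ?_, ?_, by simp⟩
    · simpa using isDyadic_zero
    · have : f 0 = 0 := f.map_bot
      rw [this]; simpa using isDyadic_zero
  have hy0 : (0 : unitInterval) < y := unitInterval.pos_iff_ne_zero.2 hy
  set A := (insert 0 s).filter (fun t => t < y) with hA
  have hAne : A.Nonempty := ⟨0, by simp [hA, hy0]⟩
  set a := A.max' hAne with ha
  have haA : a ∈ A := A.max'_mem hAne
  have hay : a < y := (Finset.mem_filter.1 haA).2
  have hd : IsDyadic (a : ℝ) ∧ IsDyadic (f a : ℝ) := by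
    rcases Finset.mem_insert.1 (Finset.mem_filter.1 haA).1 with h0 | h0
    · rw [h0]
      have : f 0 = 0 := f.map_bot
      rw [this]; exact ⟨by simpa using isDyadic_zero, by simpa using isDyadic_zero⟩
    · exact hs a h0
  obtain ⟨k, hk⟩ := h a y hay (fun t ht hty => by
    have : t ≤ a := A.le_max' t (by simp [hA, ht, hty.2])
    exact absurd hty.1 (not_lt.2 this))
  exact ⟨a, k, hd.1, hd.2, hk y ⟨hay.le, le_rfl⟩⟩

lemma IsDyadicPL.map_dyadic {f : unitInterval ≃o unitInterval} (hf : IsDyadicPL f)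
    {y : unitInterval} (hy : IsDyadic (y : ℝ)) : IsDyadic (f y : ℝ) := by
  obtain ⟨a, k, h1, h2, h3⟩ := hf.exists_segment y
  rw [h3]
  exact h2.add ((hy.add h1.neg).zpow_mul k)

lemma IsDyadicPL.symm {f : unitInterval ≃o unitInterval} (hf : IsDyadicPL f) :
    IsDyadicPL f.symm := by
  classical
  obtain ⟨s, hs, h⟩ := hf
  refine ⟨s.image f, ?_, ?_⟩
  · intro t ht
    obtain ⟨u, hu, rfl⟩ := Finset.mem_image.1 ht
    simpa using (hs u hu).symm
  · intro a b hab hno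
    obtain ⟨k, hk⟩ := h (f.symm a) (f.symm b) (f.symm.lt_iff_lt.2 hab) (fun t ht hm =>
      hno (f t) (Finset.mem_image_of_mem f ht)
        ⟨f.symm_apply_lt.1 hm.1, f.lt_symm_apply.1 hm.2⟩)
    refine ⟨-k, fun x hx => ?_⟩
    have := hk (f.symm x) ⟨f.symm.monotone hx.1, f.symm.monotone hx.2⟩
    rw [f.apply_symm_apply, f.apply_symm_apply] at this
    rw [this, zpow_neg]
    have h2 : (2 : ℝ) ^ k ≠ 0 := by positivity
    field_simp
    ring

lemma IsDyadicPL.trans {f g : unitInterval ≃o unitInterval} (hf : IsDyadicPL f)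
    (hg : IsDyadicPL g) : IsDyadicPL (f.trans g) := by
  classical
  have hf' := hf
  have hg' := hg
  obtain ⟨s, hs, h⟩ := hf
  obtain ⟨s', hs', h'⟩ := hg
  refine ⟨s ∪ s'.image f.symm, ?_, ?_⟩
  · intro t ht
    have hd : IsDyadic (t : ℝ) := by
      rcases Finset.mem_union.1 ht with ht | ht
      · exact (hs t ht).1
      · obtain ⟨u, hu, rfl⟩ := Finset.mem_image.1 ht
        exact hf'.symm.map_dyadic (hs' u hu).1
    exact ⟨hd, hg'.map_dyadic (hf'.map_dyadic hd)⟩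
  · intro a b hab hno
    obtain ⟨k, hk⟩ := h a b hab (fun t ht => hno t (Finset.mem_union_left _ ht))
    obtain ⟨l, hl⟩ := h' (f a) (f b) (f.lt_iff_lt.2 hab) (fun t ht hm =>
      hno (f.symm t) (Finset.mem_union_right _ (Finset.mem_image_of_mem _ ht))
        ⟨f.lt_symm_apply.2 hm.1, f.symm_apply_lt.2 hm.2⟩)
    refine ⟨l + k, fun x hx => ?_⟩
    have h1 := hk x hx
    have h2 := hl (f x) ⟨f.monotone hx.1, f.monotone hx.2⟩
    simp only [OrderIso.trans_apply]
    rw [h2, h1, zpow_add₀ (by norm_num)]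
    ring

lemma isDyadicPL_refl : IsDyadicPL (OrderIso.refl unitInterval) :=
  ⟨∅, by simp, fun a b _ _ => ⟨0, fun x _ => by simp⟩⟩

/-- R. Thompson's group `F`. The product is composition from left to right (`f * g` is `f`
followed by `g`), which is why it is a subgroup of the opposite of the group of order isomorphisms
under `∘`. -/
def ThompsonF : Subgroup (unitInterval ≃o unitInterval)ᵐᵒᵖ where
  carrier := {f | IsDyadicPL f.unop}
  mul_mem' {_ _} hf hg := IsDyadicPL.trans hf hg
  one_mem' := isDyadicPL_refl
  inv_mem' {_} hf := IsDyadicPL.symm hf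

namespace ThompsonF

/-- The homeomorphism `x₀`. -/
noncomputable def x₀Iso : unitInterval ≃o unitInterval where
  toFun t := ⟨if (t : ℝ) ≤ 1 / 4 then 2 * t else
      if (t : ℝ) ≤ 1 / 2 then t + 1 / 4 else t / 2 + 1 / 2, by
    have h0 := t.2.1
    have h1 := t.2.2
    split_ifs <;> constructor <;> linarith⟩
  invFun t := ⟨if (t : ℝ) ≤ 1 / 2 then t / 2 else
      if (t : ℝ) ≤ 3 / 4 then t - 1 / 4 else 2 * t - 1, by
    have h0 := t.2.1
    have h1 := t.2.2
    split_ifs <;> constructor <;> linarith⟩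
  left_inv t := by
    apply Subtype.ext
    dsimp only
    split_ifs <;> linarith
  right_inv t := by
    apply Subtype.ext
    dsimp only
    split_ifs <;> linarith
  map_rel_iff' {a b} := by
    simp only [Equiv.coe_fn_mk, ← Subtype.coe_le_coe]
    split_ifs <;> constructor <;> intro h <;> linarith

/-- The homeomorphism `x₁`. -/
noncomputable def x₁Iso : unitInterval ≃o unitInterval where
  toFun t := ⟨if (t : ℝ) ≤ 1 / 2 then t else
      if (t : ℝ) ≤ 5 / 8 then 2 * t - 1 / 2 else
      if (t : ℝ) ≤ 3 / 4 then t + 1 / 8 else t / 2 + 1 / 2, by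
    have h0 := t.2.1
    have h1 := t.2.2
    split_ifs <;> constructor <;> linarith⟩
  invFun t := ⟨if (t : ℝ) ≤ 1 / 2 then t else
      if (t : ℝ) ≤ 3 / 4 then t / 2 + 1 / 4 else
      if (t : ℝ) ≤ 7 / 8 then t - 1 / 8 else 2 * t - 1, by
    have h0 := t.2.1
    have h1 := t.2.2
    split_ifs <;> constructor <;> linarith⟩
  left_inv t := by
    apply Subtype.ext
    dsimp only
    split_ifs <;> linarith
  right_inv t := by
    apply Subtype.ext
    dsimp only
    split_ifs <;> linarith
  map_rel_iff' {a b} := by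
    simp only [Equiv.coe_fn_mk, ← Subtype.coe_le_coe]
    split_ifs <;> constructor <;> intro h <;> linarith

lemma coe_x₀Iso (t : unitInterval) : (x₀Iso t : ℝ) = if (t : ℝ) ≤ 1 / 4 then 2 * (t : ℝ) else
    if (t : ℝ) ≤ 1 / 2 then (t : ℝ) + 1 / 4 else (t : ℝ) / 2 + 1 / 2 := rfl

lemma coe_x₁Iso (t : unitInterval) : (x₁Iso t : ℝ) = if (t : ℝ) ≤ 1 / 2 then (t : ℝ) else
    if (t : ℝ) ≤ 5 / 8 then 2 * (t : ℝ) - 1 / 2 else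
    if (t : ℝ) ≤ 3 / 4 then (t : ℝ) + 1 / 8 else (t : ℝ) / 2 + 1 / 2 := rfl

lemma isDyadicPL_x₀Iso : IsDyadicPL x₀Iso := by
  classical
  refine ⟨{⟨1 / 4, by norm_num, by norm_num⟩, ⟨1 / 2, by norm_num, by norm_num⟩}, ?_, ?_⟩
  · intro t ht
    simp only [Finset.mem_insert, Finset.mem_singleton] at ht
    rcases ht with rfl | rfl
    · exact ⟨⟨1, 2, by norm_num⟩, ⟨1, 1, by norm_num [x₀Iso]⟩⟩
    · exact ⟨⟨1, 1, by norm_num⟩, ⟨3, 2, by norm_num [x₀Iso]⟩⟩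
  · intro a b hab h
    have hab' : (a : ℝ) < b := hab
    simp only [Finset.mem_insert, Finset.mem_singleton, forall_eq_or_imp, forall_eq, Set.mem_Ioo,
      not_and, not_lt, ← Subtype.coe_lt_coe] at h
    obtain ⟨h1, h2⟩ := h
    by_cases c1 : (a : ℝ) < 1 / 4
    · refine ⟨1, fun x hx => ?_⟩
      have hx1 : (a : ℝ) ≤ x := hx.1
      have hx2 : (x : ℝ) ≤ b := hx.2
      have := h1 c1
      simp only [coe_x₀Iso, zpow_one]
      split_ifs <;> linarith
    · by_cases c2 : (a : ℝ) < 1 / 2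
      · refine ⟨0, fun x hx => ?_⟩
        have hx1 : (a : ℝ) ≤ x := hx.1
        have hx2 : (x : ℝ) ≤ b := hx.2
        have := h2 c2
        simp only [coe_x₀Iso, zpow_zero]
        split_ifs <;> linarith
      · refine ⟨-1, fun x hx => ?_⟩
        have hx1 : (a : ℝ) ≤ x := hx.1
        simp only [coe_x₀Iso, zpow_neg, zpow_one]
        split_ifs <;> linarith

lemma isDyadicPL_x₁Iso : IsDyadicPL x₁Iso := by
  classical
  refine ⟨{⟨1 / 2, by norm_num, by norm_num⟩, ⟨5 / 8, by norm_num, by norm_num⟩,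
    ⟨3 / 4, by norm_num, by norm_num⟩}, ?_, ?_⟩
  · intro t ht
    simp only [Finset.mem_insert, Finset.mem_singleton] at ht
    rcases ht with rfl | rfl | rfl
    · exact ⟨⟨1, 1, by norm_num⟩, ⟨1, 1, by norm_num [x₁Iso]⟩⟩
    · exact ⟨⟨5, 3, by norm_num⟩, ⟨3, 2, by norm_num [x₁Iso]⟩⟩
    · exact ⟨⟨3, 2, by norm_num⟩, ⟨7, 3, by norm_num [x₁Iso]⟩⟩
  · intro a b hab h
    have hab' : (a : ℝ) < b := hab
    simp only [Finset.mem_insert, Finset.mem_singleton, forall_eq_or_imp, forall_eq, Set.mem_Ioo,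
      not_and, not_lt, ← Subtype.coe_lt_coe] at h
    obtain ⟨h1, h2, h3⟩ := h
    by_cases c1 : (a : ℝ) < 1 / 2
    · refine ⟨0, fun x hx => ?_⟩
      have hx1 : (a : ℝ) ≤ x := hx.1
      have hx2 : (x : ℝ) ≤ b := hx.2
      have := h1 c1
      simp only [coe_x₁Iso, zpow_zero]
      split_ifs <;> linarith
    · by_cases c2 : (a : ℝ) < 5 / 8
      · refine ⟨1, fun x hx => ?_⟩
        have hx1 : (a : ℝ) ≤ x := hx.1
        have hx2 : (x : ℝ) ≤ b := hx.2
        have := h2 c2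
        simp only [coe_x₁Iso, zpow_one]
        split_ifs <;> linarith
      · by_cases c3 : (a : ℝ) < 3 / 4
        · refine ⟨0, fun x hx => ?_⟩
          have hx1 : (a : ℝ) ≤ x := hx.1
          have hx2 : (x : ℝ) ≤ b := hx.2
          have := h3 c3
          simp only [coe_x₁Iso, zpow_zero]
          split_ifs <;> linarith
        · refine ⟨-1, fun x hx => ?_⟩
          have hx1 : (a : ℝ) ≤ x := hx.1
          simp only [coe_x₁Iso, zpow_neg, zpow_one]
          split_ifs <;> linarith

/-- The generators `x₀, x₁, x₂, …` of `F`, where `x (i + 1) = x₀ ^ (-i) * x₁ * x₀ ^ i`. -/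
noncomputable def x : ℕ → ThompsonF
  | 0 => ⟨MulOpposite.op x₀Iso, isDyadicPL_x₀Iso⟩
  | i + 1 => (⟨MulOpposite.op x₀Iso, isDyadicPL_x₀Iso⟩ ^ i)⁻¹ * ⟨MulOpposite.op x₁Iso, isDyadicPL_x₁Iso⟩ *
      ⟨MulOpposite.op x₀Iso, isDyadicPL_x₀Iso⟩ ^ i

/-- Jones' subgroup of `F`, generated by `x₀x₁`, `x₁x₂` and `x₂x₃`. -/
noncomputable def jones : Subgroup ThompsonF :=
  Subgroup.closure {x 0 * x 1, x 1 * x 2, x 2 * x 3}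

/-- The subgroup `G` of `F` generated by `y₀ = x₀x₂` and `y₁ = x₁x₂`. -/
noncomputable def G : Subgroup ThompsonF :=
  Subgroup.closure {x 0 * x 2, x 1 * x 2}

end ThompsonF

/-! A finite binary word names a dyadic interval, and every element of `F` matches, affinely and in
order, the tiles of two dyadic tilings of `[0, 1]` (`exists_tiles`). The decisive invariant is the
parity of the number of digits `1` of a word; it depends only on the left endpoint of the interval
(`parity_eq_of_start_eq`).

Jones' subgroup consists of the elements that preserve this parity along some tiling. Adding carets
makes the parities alternate (`exists_alternates`). A tiling with alternating parities and an even
number of tiles arises from the halves `0` and `1` by ternary carets, replacing `w` by `w0`, `w10`,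
`w11` (`Subdivides.ternary`). The product `x i * x (i + 1)` straightens such a caret into a right
comb, so any two such tilings of equal length are matched by an element of `jones`
(`mem_jones_of_parity_eq`). The converse is `preservesParity_of_mem_jones`. The same straightening
with ordinary carets and single `x i` shows that `x 0` and `x 1` generate `F`.

Padding tilings outside a block makes `jones` transitive on alternating blocks away from `0` and `1`
(`exists_mem_jones_forall₂_maps`). Let `M` contain `jones` and some `f` outside it. Some tile
changes parity under `f` while its left neighbour does not; moving this pair by `jones` turns `f` or
its inverse into some `g` in `M` that agrees with `x 0` on `[3/8, 3/4]`. Conjugation by `g` acts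
like conjugation by `x 0` on elements supported there, which puts one explicit word into `M`
(`conj_mem_of_maps`), and the relations of `F` then give `G ≤ M` (`G_le_of_mem`).

The slope at `1` of an element of `G` is an even power of `2`, while `G` contains all products of
two of the generators `x 0`, `x 1`; hence the index is `2`. Even powers of `x 0` change the parity
at `1/4` and so give infinitely many cosets of `jones` in `G`. -/

namespace ThompsonF

/-! ### Binary words and dyadic intervals -/

/-- The increasing affine map of `ℝ` that takes `[0, 1]` onto the dyadic interval of the reals
whose binary expansion begins with `u`. -/
noncomputable def affine : List Bool → ℝ → ℝ
  | [], t => t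
  | b :: u, t => ((if b then 1 else 0) + affine u t) / 2

/-- The left endpoint of the dyadic interval of `u`. -/
noncomputable def start (u : List Bool) : ℝ := affine u 0

/-- The length of the dyadic interval of `u`. -/
noncomputable def width (u : List Bool) : ℝ := (1 / 2) ^ u.length

lemma width_pos (u : List Bool) : 0 < width u := by unfold width; positivity

lemma affine_eq (u : List Bool) (t : ℝ) : affine u t = start u + width u * t := by
  induction u with
  | nil => simp [affine, start, width]
  | cons b u ih =>
    have : width (b :: u) = width u / 2 := by simp [width, pow_succ]; ring
    rw [this]
    simp only [start, affine] at ih ⊢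
    rw [ih]; ring

@[simp] lemma start_nil : start [] = 0 := rfl

@[simp] lemma width_nil : width [] = 1 := by simp [width]

lemma start_cons (b : Bool) (u : List Bool) :
    start (b :: u) = ((if b then 1 else 0) + start u) / 2 := rfl

lemma width_cons (b : Bool) (u : List Bool) : width (b :: u) = width u / 2 := by
  simp [width, pow_succ]; ring

lemma affine_append (u v : List Bool) (t : ℝ) : affine (u ++ v) t = affine u (affine v t) := by
  induction u with
  | nil => rfl
  | cons b u ih => simp [affine, ih]

lemma width_append (u v : List Bool) : width (u ++ v) = width u * width v := by
  simp [width, pow_add]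

lemma start_append (u v : List Bool) : start (u ++ v) = start u + width u * start v := by
  rw [start, affine_append, affine_eq]; rfl

lemma start_append_false (u : List Bool) : start (u ++ [false]) = start u := by
  simp [start_append, start_cons]

lemma start_append_true (u : List Bool) : start (u ++ [true]) = start u + width u / 2 := by
  simp [start_append, start_cons]; ring

lemma width_append_singleton (u : List Bool) (b : Bool) : width (u ++ [b]) = width u / 2 := by
  simp [width_append, width_cons]; ring

lemma start_nonneg (u : List Bool) : 0 ≤ start u := by
  induction u with
  | nil => simp
  | cons b u ih => rw [start_cons]; cases b <;> simp <;> linarith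

lemma start_add_width_le (u : List Bool) : start u + width u ≤ 1 := by
  induction u with
  | nil => simp
  | cons b u ih => rw [start_cons, width_cons]; cases b <;> simp <;> linarith

lemma start_lt_one (u : List Bool) : start u < 1 := by
  linarith [start_add_width_le u, width_pos u]

lemma affine_mem (u : List Bool) (t : unitInterval) : affine u t ∈ unitInterval := by
  rw [affine_eq]
  have := start_nonneg u
  have := width_pos u
  have := start_add_width_le u
  have h0 := t.2.1
  have h1 := t.2.2
  constructor
  · positivity
  · nlinarith

/-- The affine map of `[0, 1]` onto the dyadic interval of `u`. -/
noncomputable def branch (u : List Bool) (t : unitInterval) : unitInterval :=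
  ⟨affine u t, affine_mem u t⟩

lemma coe_branch (u : List Bool) (t : unitInterval) :
    (branch u t : ℝ) = start u + width u * t := affine_eq u t

@[simp] lemma branch_nil (t : unitInterval) : branch [] t = t := rfl

lemma branch_append (u v : List Bool) (t : unitInterval) :
    branch (u ++ v) t = branch u (branch v t) := Subtype.ext (affine_append u v t)

lemma exists_branch_eq {u : List Bool} {t : unitInterval} (h : start u ≤ t)
    (h' : (t : ℝ) ≤ start u + width u) : ∃ s, t = branch u s := by
  have hw := width_pos u
  refine ⟨⟨(t - start u) / width u, by apply div_nonneg <;> linarith,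
    by rw [div_le_one hw]; linarith⟩, Subtype.ext ?_⟩
  rw [coe_branch]
  simp only
  field_simp
  ring

lemma exists_branch_singleton (t : unitInterval) : ∃ b s, t = branch [b] s := by
  have h0 := t.2.1
  have h1 := t.2.2
  rcases le_total (t : ℝ) (1 / 2) with h | h
  · exact ⟨false, exists_branch_eq (by simpa [start_cons])
      (by simpa [start_cons, width_cons] using h)⟩
  · refine ⟨true, exists_branch_eq ?_ ?_⟩
    · norm_num [start_cons]; linarith
    · norm_num [start_cons, width_cons]; linarith

/-! ### Parity of digit sums -/

/-- The parity of the number of digits `1`. -/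
def parity : List Bool → Bool
  | [] => false
  | b :: u => b ^^ parity u

lemma parity_append (u v : List Bool) : parity (u ++ v) = (parity u ^^ parity v) := by
  induction u with
  | nil => simp [parity]
  | cons b u ih => simp [parity, ih]

@[simp] lemma parity_append_false (u : List Bool) : parity (u ++ [false]) = parity u := by
  simp [parity_append, parity]

@[simp] lemma parity_append_true (u : List Bool) : parity (u ++ [true]) = !parity u := by
  simp [parity_append, parity]

lemma parity_eq_false_of_start_eq_zero {u : List Bool} (h : start u = 0) : parity u = false := by
  induction u with
  | nil => rfl
  | cons b u ih =>
    have := start_nonneg u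
    rw [start_cons] at h
    cases b
    · simp [parity, ih (by simpa using h)]
    · simp at h; linarith

/-- Two words with the same left endpoint differ only by trailing zeros, so parity is a function on
the dyadic fractions in `[0, 1)`. -/
lemma parity_eq_of_start_eq : ∀ {u v : List Bool}, start u = start v → parity u = parity v
  | [], v, h => (parity_eq_false_of_start_eq_zero h.symm).symm
  | u, [], h => parity_eq_false_of_start_eq_zero h
  | b :: u, c :: v, h => by
    have h1 := start_nonneg u
    have h2 := start_nonneg v
    have h3 := start_lt_one u
    have h4 := start_lt_one v
    rw [start_cons, start_cons] at h
    cases b <;> cases c <;> simp at h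
    · simp [parity, parity_eq_of_start_eq h]
    · linarith
    · linarith
    · simp [parity, parity_eq_of_start_eq h]

lemma eq_of_start_eq : ∀ {u v : List Bool}, u.length = v.length → start u = start v → u = v
  | [], [], _, _ => rfl
  | b :: u, c :: v, hl, h => by
    have h1 := start_nonneg u
    have h2 := start_nonneg v
    have h3 := start_lt_one u
    have h4 := start_lt_one v
    rw [start_cons, start_cons] at h
    have hl' : u.length = v.length := by simpa using hl
    cases b <;> cases c <;> simp at h
    · rw [eq_of_start_eq hl' h]
    · linarith
    · linarith
    · rw [eq_of_start_eq hl' h]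

lemma start_append_replicate_false (u : List Bool) (k : ℕ) :
    start (u ++ List.replicate k false) = start u := by
  induction k with
  | zero => simp
  | succ k ih => rw [List.replicate_succ', ← List.append_assoc, start_append_false, ih]

/-- The left endpoint of `u1` is an odd multiple of `2 ^ (-(|u| + 1))`, hence needs more than `|u|`
digits. -/
lemma start_append_true_ne {u v : List Bool} (h : v.length ≤ u.length) :
    start v ≠ start (u ++ [true]) := by
  intro h'
  obtain ⟨k, hk⟩ := Nat.exists_eq_add_of_le h
  rw [← start_append_replicate_false v (k + 1)] at h'
  have := eq_of_start_eq (by simp [hk]; ring) h'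
  rw [List.replicate_succ', ← List.append_assoc] at this
  have := (List.append_inj' this rfl).2
  simp at this

lemma exists_start_eq (n : ℕ) : ∀ N : ℤ, 0 ≤ N → N < 2 ^ n →
    ∃ u : List Bool, u.length = n ∧ start u = N / 2 ^ n := by
  induction n with
  | zero =>
    intro N h0 h1
    obtain rfl : N = 0 := by simp at h1; omega
    exact ⟨[], rfl, by simp⟩
  | succ n ih =>
    intro N h0 h1
    by_cases h : N < 2 ^ n
    · obtain ⟨u, hu, hs⟩ := ih N h0 h
      refine ⟨false :: u, by simp [hu], ?_⟩
      rw [start_cons, hs, pow_succ]; simp; field_simp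
    · obtain ⟨u, hu, hs⟩ := ih (N - 2 ^ n) (by omega) (by rw [pow_succ] at h1; omega)
      refine ⟨true :: u, by simp [hu], ?_⟩
      rw [start_cons, hs, pow_succ]; push_cast; simp; field_simp; ring

lemma _root_.IsDyadic.exists_start_eq {r : ℝ} (h : IsDyadic r) (h0 : 0 ≤ r) (h1 : r < 1) :
    ∃ u, start u = r := by
  obtain ⟨a, n, rfl⟩ := h
  have hp : (0 : ℝ) < 2 ^ n := by positivity
  rw [div_lt_one hp] at h1
  obtain ⟨u, -, hu⟩ := ThompsonF.exists_start_eq n a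
    (by have := mul_nonneg h0 hp.le; rw [div_mul_cancel₀ _ hp.ne'] at this; exact_mod_cast this) (by exact_mod_cast h1)
  exact ⟨u, hu⟩

lemma isDyadic_start (u : List Bool) : IsDyadic (start u) := by
  induction u with
  | nil => simpa using isDyadic_zero
  | cons b u ih =>
    rw [start_cons]
    have h : IsDyadic ((if b then 1 else 0 : ℝ) + start u) := by
      refine IsDyadic.add ?_ ih
      cases b
      · simpa using isDyadic_zero
      · simpa using isDyadic_one
    convert h.zpow_mul (-1) using 1
    norm_num
    ring

/-! ### The action on dyadic intervals -/

/-- The homeomorphism of `[0, 1]` underlying an element of `F`. -/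
def act (f : ThompsonF) : unitInterval ≃o unitInterval := f.1.unop

lemma act_mul (f g : ThompsonF) (t : unitInterval) : act (f * g) t = act g (act f t) := rfl

@[simp] lemma act_one (t : unitInterval) : act 1 t = t := rfl

@[simp] lemma act_inv_act (f : ThompsonF) (t : unitInterval) : act f⁻¹ (act f t) = t :=
  (act f).symm_apply_apply t

@[simp] lemma act_act_inv (f : ThompsonF) (t : unitInterval) : act f (act f⁻¹ t) = t :=
  (act f).apply_symm_apply t

lemma act_ext {f g : ThompsonF} (h : ∀ t, act f t = act g t) : f = g :=
  Subtype.ext (MulOpposite.unop_injective (OrderIso.ext (funext h)))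

lemma isDyadicPL_act (f : ThompsonF) : IsDyadicPL (act f) := f.2

/-- If `h` is the identity off `s` and `f`, `g` agree on `s`, then `f` and `g` conjugate `h` to
the same element. -/
lemma conj_eq_of_agree {f g h : ThompsonF} (s : Set unitInterval)
    (hfg : ∀ t ∈ s, act f t = act g t) (hh : ∀ t ∉ s, act h t = t) :
    f⁻¹ * h * f = g⁻¹ * h * g := by
  have key : ∀ t, act (h * f) t = act (f * g⁻¹ * h * g) t := by
    intro t
    simp only [act_mul]
    by_cases ht : t ∈ s
    · have : act h t ∈ s := by
        by_contra hn
        have := (act h).injective (hh _ hn)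
        rw [this] at hn
        exact hn ht
      rw [hfg _ this, hfg _ ht, act_inv_act]
    · rw [hh t ht]
      have h2 : act g⁻¹ (act f t) ∉ s := by
        intro hs
        have := hfg _ hs
        rw [act_act_inv] at this
        have := (act f).injective this
        exact ht (this ▸ hs)
      rw [hh _ h2, act_act_inv]
  have := act_ext key
  rw [mul_assoc, this]
  group

/-- `f` takes the dyadic interval of `u` affinely onto the dyadic interval of `v`. -/
def Maps (f : ThompsonF) (u v : List Bool) : Prop := ∀ t, act f (branch u t) = branch v t

lemma Maps.append {f : ThompsonF} {u v : List Bool} (h : Maps f u v) (w : List Bool) :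
    Maps f (u ++ w) (v ++ w) := fun t => by rw [branch_append, h, branch_append]

lemma Maps.mul {f g : ThompsonF} {u v w : List Bool} (h : Maps f u v) (h' : Maps g v w) :
    Maps (f * g) u w := fun t => by rw [act_mul, h, h']

lemma Maps.inv {f : ThompsonF} {u v : List Bool} (h : Maps f u v) : Maps f⁻¹ v u :=
  fun t => by rw [← h t, act_inv_act]

lemma maps_one (u : List Bool) : Maps 1 u u := fun _ => rfl

lemma Maps.merge {f : ThompsonF} {u v : List Bool} (h0 : Maps f (u ++ [false]) (v ++ [false]))
    (h1 : Maps f (u ++ [true]) (v ++ [true])) : Maps f u v := by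
  intro t
  obtain ⟨b, s, rfl⟩ := exists_branch_singleton t
  rw [← branch_append, ← branch_append]
  cases b
  · exact h0 s
  · exact h1 s

lemma Maps.act_start {f : ThompsonF} {u v : List Bool} (h : Maps f u v) {t : unitInterval}
    (ht : (t : ℝ) = start u) : (act f t : ℝ) = start v := by
  have : t = branch u 0 := Subtype.ext (by rw [ht, coe_branch]; simp)
  rw [this, h, coe_branch]; simp

lemma Maps.act_end {f : ThompsonF} {u v : List Bool} (h : Maps f u v) {t : unitInterval}
    (ht : (t : ℝ) = start u + width u) : (act f t : ℝ) = start v + width v := by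
  have : t = branch u 1 := Subtype.ext (by rw [ht, coe_branch]; simp)
  rw [this, h, coe_branch]; simp

lemma maps_iff {f : ThompsonF} {u v : List Bool} : Maps f u v ↔
    ∀ t : unitInterval, (act f (branch u t) : ℝ) = start v + width v * t :=
  forall_congr' fun t => by rw [Subtype.ext_iff, coe_branch v]

/-! ### Tilings -/

/-- The dyadic intervals of the words of `L` are consecutive and fill `[a, b]`. -/
def Tiles : ℝ → List (List Bool) → ℝ → Prop
  | a, [], b => a = b
  | a, u :: L, b => start u = a ∧ Tiles (a + width u) L b

/-- The parities of the words of `L` alternate, beginning with `p`; the next one would be `q`. -/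
def Alternates : Bool → List (List Bool) → Bool → Prop
  | p, [], q => p = q
  | p, u :: L, q => parity u = p ∧ Alternates (!p) L q

lemma tiles_append {a b : ℝ} {L L' : List (List Bool)} :
    Tiles a (L ++ L') b ↔ ∃ c, Tiles a L c ∧ Tiles c L' b := by
  induction L generalizing a with
  | nil => simp [Tiles]
  | cons u L ih => simp [Tiles, ih, and_assoc]

lemma alternates_append {p q : Bool} {L L' : List (List Bool)} :
    Alternates p (L ++ L') q ↔ ∃ r, Alternates p L r ∧ Alternates r L' q := by
  induction L generalizing p with
  | nil => simp [Alternates]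
  | cons u L ih => simp [Alternates, ih, and_assoc]

lemma Tiles.le {a b : ℝ} {L : List (List Bool)} (h : Tiles a L b) : a ≤ b := by
  induction L generalizing a with
  | nil => exact le_of_eq h
  | cons u L ih => linarith [ih h.2, width_pos u]

lemma Tiles.exists_cons {a b : ℝ} {L : List (List Bool)} (h : Tiles a L b) (hab : a < b) :
    ∃ u L', L = u :: L' := by
  cases L with
  | nil => exact absurd h hab.ne
  | cons u L => exact ⟨u, L, rfl⟩

lemma Tiles.exists_mem {a b : ℝ} {L : List (List Bool)} (h : Tiles a L b) {t : ℝ} (hat : a ≤ t)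
    (htb : t < b) : ∃ u ∈ L, start u ≤ t ∧ t < start u + width u := by
  induction L generalizing a with
  | nil => simp only [Tiles] at h; linarith
  | cons u L ih =>
    obtain ⟨rfl, h⟩ := h
    rcases lt_or_ge t (start u + width u) with ht | ht
    · exact ⟨u, by simp, hat, ht⟩
    · obtain ⟨w, hw, h'⟩ := ih h ht
      exact ⟨w, by simp [hw], h'⟩

lemma Tiles.exists_mem_one {L : List (List Bool)} (h : Tiles 0 L 1) (t : unitInterval) :
    ∃ u ∈ L, ∃ s, t = branch u s := by
  rcases t.2.2.lt_or_eq with ht | ht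
  · obtain ⟨u, hu, h1, h2⟩ := h.exists_mem t.2.1 ht
    exact ⟨u, hu, exists_branch_eq h1 h2.le⟩
  · obtain ⟨v, L', rfl⟩ := h.exists_cons (by norm_num)
    rcases List.eq_nil_or_concat (v :: L') with h0 | ⟨L1, u, h0⟩
    · simp at h0
    · rw [h0] at h ⊢
      rw [List.concat_eq_append, tiles_append] at h
      obtain ⟨c, -, h1, h2⟩ := h
      simp only [Tiles] at h2
      exact ⟨u, by simp, exists_branch_eq (by rw [ht]; exact (start_lt_one u).le)
        (by rw [ht, h1, h2])⟩

lemma Tiles.forall_maps {f : ThompsonF} {L L' : List (List Bool)} (hL : Tiles 0 L 1)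
    (h : List.Forall₂ (Maps f) L L') : Tiles 0 L' 1 := by
  have key : ∀ (L L' : List (List Bool)) (a b : unitInterval), Tiles a L b →
      List.Forall₂ (Maps f) L L' → Tiles (act f a) L' (act f b) := by
    intro L L' a b hL h
    induction h generalizing a with
    | nil =>
      have : a = b := Subtype.ext hL
      rw [this]; rfl
    | @cons u v L L' huv _ ih =>
      obtain ⟨h1, h2⟩ := hL
      have hle : (a : ℝ) + width u ∈ unitInterval :=
        ⟨by linarith [a.2.1, width_pos u], by linarith [start_add_width_le u]⟩
      refine ⟨(huv.act_start h1.symm).symm, ?_⟩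
      have := ih ⟨_, hle⟩ h2
      rwa [huv.act_end (by rw [h1]), ← huv.act_start h1.symm] at this
  have := key L L' 0 1 (by simpa using hL) h
  have h0 : act f 0 = 0 := (act f).map_bot
  have h1 : act f 1 = 1 := (act f).map_top
  rw [h0, h1] at this
  simpa using this

lemma forall₂_maps_mul {f g : ThompsonF} {L L' L'' : List (List Bool)}
    (h : List.Forall₂ (Maps f) L L') (h' : List.Forall₂ (Maps g) L' L'') :
    List.Forall₂ (Maps (f * g)) L L'' := by
  induction h generalizing L'' with
  | nil => cases h'; exact .nil
  | cons h1 _ ih => cases h' with | cons h2 h3 => exact .cons (h1.mul h2) (ih h3)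

lemma forall₂_maps_inv {f : ThompsonF} {L L' : List (List Bool)}
    (h : List.Forall₂ (Maps f) L L') : List.Forall₂ (Maps f⁻¹) L' L := by
  induction h with
  | nil => exact .nil
  | cons h1 _ ih => exact .cons h1.inv ih

lemma eq_one_of_forall₂_maps {f : ThompsonF} {L : List (List Bool)} (hL : Tiles 0 L 1)
    (h : List.Forall₂ (Maps f) L L) : f = 1 := by
  refine act_ext fun t => ?_
  obtain ⟨u, hu, s, rfl⟩ := hL.exists_mem_one t
  exact List.forall₂_same.1 h u hu s

/-- A pair of tilings determines the element. This turns the construction of a suitable element of a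
subgroup into a proof of membership. -/
lemma eq_of_forall₂_maps {f g : ThompsonF} {L L' : List (List Bool)} (hL : Tiles 0 L 1)
    (h : List.Forall₂ (Maps f) L L') (h' : List.Forall₂ (Maps g) L L') : f = g :=
  mul_inv_eq_one.1 (eq_one_of_forall₂_maps hL (forall₂_maps_mul h (forall₂_maps_inv h')))

/-! ### Every element is given by a pair of tilings -/

lemma start_eq_div (u : List Bool) : ∃ N : ℤ, start u = N / 2 ^ u.length := by
  induction u with
  | nil => exact ⟨0, by simp⟩
  | cons b u ih =>
    obtain ⟨N, hN⟩ := ih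
    refine ⟨(if b then 1 else 0) * 2 ^ u.length + N, ?_⟩
    rw [start_cons, hN, List.length_cons, pow_succ]
    cases b <;> simp <;> field_simp

lemma exists_tiles_of_append (f : ThompsonF) (j : ℕ) : ∀ u : List Bool,
    (∀ w : List Bool, w.length = j → ∃ L L',
      Tiles (start (u ++ w)) L (start (u ++ w) + width (u ++ w)) ∧
      List.Forall₂ (Maps f) L L') →
    ∃ L L', Tiles (start u) L (start u + width u) ∧ List.Forall₂ (Maps f) L L' := by
  induction j with
  | zero => intro u h; simpa using h [] rfl
  | succ j ih =>
    intro u h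
    obtain ⟨L₀, L₀', h₀, h₀'⟩ := ih (u ++ [false]) fun w hw => by
      simpa using h (false :: w) (by simp [hw])
    obtain ⟨L₁, L₁', h₁, h₁'⟩ := ih (u ++ [true]) fun w hw => by
      simpa using h (true :: w) (by simp [hw])
    refine ⟨L₀ ++ L₁, L₀' ++ L₁', tiles_append.2 ⟨start u + width u / 2, ?_, ?_⟩,
      List.rel_append h₀' h₁'⟩
    · rwa [start_append_false, width_append_singleton] at h₀
    · rw [start_append_true, width_append_singleton] at h₁
      convert h₁ using 1
      ring

lemma exists_maps_of_affine (f : ThompsonF) (u : List Bool) (k : ℤ)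
    (h : ∀ t, (act f (branch u t) : ℝ) = act f (branch u 0) + 2 ^ k * t)
    (hd : IsDyadic (act f (branch u 0))) :
    ∃ j, ∀ w : List Bool, w.length = j → ∃ v, Maps f (u ++ w) v := by
  obtain ⟨a, m, ha⟩ := hd
  -- Cutting into `2 ^ j` parts gives images of length `2 ^ (k - j)`. The image begins at a multiple
  -- of `2 ^ (-m)`, so its parts are standard dyadic intervals once `j - k ≥ m`.
  obtain ⟨j, hj⟩ : ∃ j : ℕ, k + m ≤ j := ⟨(k + m).toNat, Int.self_le_toNat _⟩
  obtain ⟨l, hl⟩ : ∃ l : ℕ, (l : ℤ) = j - k - m :=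
    ⟨(j - k - m).toNat, Int.toNat_of_nonneg (by omega)⟩
  refine ⟨j, fun w hw => ?_⟩
  obtain ⟨N, hN⟩ := start_eq_div w
  have hk : (2 : ℝ) ^ k * 2 ^ m * 2 ^ l = 2 ^ j := by
    rw [← zpow_natCast, ← zpow_natCast, ← zpow_natCast, ← zpow_add₀ (by norm_num),
      ← zpow_add₀ (by norm_num)]
    congr 1
    omega
  have key : ∀ t, (act f (branch (u ++ w) t) : ℝ) =
      ((a * 2 ^ l + N : ℤ) : ℝ) / 2 ^ (m + l) + (1 / 2) ^ (m + l) * t := by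
    intro t
    rw [branch_append, h, ha, coe_branch, hN, width, hw, one_div_pow, one_div_pow, ← hk, pow_add]
    push_cast
    have : (2 : ℝ) ^ k ≠ 0 := by positivity
    field_simp
    ring
  have h0 := key 0
  have h1 := key 1
  have hp : (0 : ℝ) < 2 ^ (m + l) := by positivity
  obtain ⟨v, hv, hs⟩ := exists_start_eq (m + l) (a * 2 ^ l + N) (by
      have := (act f (branch (u ++ w) 0)).2.1
      rw [h0] at this
      have := mul_nonneg this hp.le
      simp only [Set.Icc.coe_zero, mul_zero, add_zero] at this
      rw [div_mul_cancel₀ _ hp.ne'] at this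
      exact_mod_cast this) (by
      have := (act f (branch (u ++ w) 1)).2.2
      rw [h1, Set.Icc.coe_one, one_div_pow, mul_one, ← add_div, div_le_one hp] at this
      have : (a * 2 ^ l + N) + 1 ≤ (2 : ℤ) ^ (m + l) := by exact_mod_cast this
      omega)
  exact ⟨v, maps_iff.2 fun t => by rw [key, hs, width, hv]⟩

lemma exists_common_denominator (s : Finset unitInterval) (hs : ∀ t ∈ s, IsDyadic (t : ℝ)) :
    ∃ n : ℕ, ∀ m ≥ n, ∀ t ∈ s, ∃ N : ℤ, (t : ℝ) = N / 2 ^ m := by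
  classical
  induction s using Finset.induction_on with
  | empty => exact ⟨0, by simp⟩
  | insert t s _ ih =>
    obtain ⟨n, hn⟩ := ih fun t ht => hs t (by simp [ht])
    obtain ⟨a, k, hk⟩ := hs t (by simp)
    refine ⟨max n k, fun m hm t' ht' => ?_⟩
    rcases Finset.mem_insert.1 ht' with rfl | ht'
    · obtain ⟨i, rfl⟩ := Nat.exists_eq_add_of_le (le_of_max_le_right hm)
      exact ⟨a * 2 ^ i, by rw [hk, pow_add]; push_cast; field_simp⟩
    · exact hn m (le_of_max_le_left hm) t' ht'

/-- Every element of `F` takes the intervals of some dyadic subdivision affinely onto dyadic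
intervals. -/
lemma exists_tiles (f : ThompsonF) :
    ∃ L L', Tiles 0 L 1 ∧ Tiles 0 L' 1 ∧ List.Forall₂ (Maps f) L L' := by
  obtain ⟨s, hs, h⟩ := isDyadicPL_act f
  obtain ⟨n, hn⟩ := exists_common_denominator s fun t ht => (hs t ht).1
  obtain ⟨L, L', hL, hf⟩ := exists_tiles_of_append f n [] fun u hu => by
    have hlt : (branch ([] ++ u) 0 : unitInterval) < branch ([] ++ u) 1 := by
      rw [← Subtype.coe_lt_coe, coe_branch, coe_branch]
      simpa using width_pos u
    -- All breakpoints are multiples of `2 ^ (-n)`, so none is interior to a dyadic interval of that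
    -- length.
    obtain ⟨k, hk⟩ := h (branch ([] ++ u) 0) (branch ([] ++ u) 1) hlt fun t ht hm => by
      obtain ⟨N, hN⟩ := hn n le_rfl t ht
      obtain ⟨N', hN'⟩ := start_eq_div u
      have h1 : ((branch ([] ++ u) 0 : unitInterval) : ℝ) < t := hm.1
      have h2 : (t : ℝ) < (branch ([] ++ u) 1 : unitInterval) := hm.2
      rw [coe_branch, hN, List.nil_append, hN', hu] at h1
      rw [coe_branch, hN, List.nil_append, hN', hu, width, hu, one_div_pow, Set.Icc.coe_one,
        mul_one, ← add_div] at h2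
      simp only [Set.Icc.coe_zero, mul_zero, add_zero] at h1
      have hp : (0 : ℝ) < 2 ^ n := by positivity
      rw [div_lt_div_iff_of_pos_right hp] at h1 h2
      have h1' : N' < N := by exact_mod_cast h1
      have h2' : N < N' + 1 := by exact_mod_cast h2
      omega
    have haff : ∀ t, (act f (branch ([] ++ u) t) : ℝ) =
        act f (branch ([] ++ u) 0) + 2 ^ (k - n) * t := by
      intro t
      rw [hk _ ⟨?_, ?_⟩, coe_branch, coe_branch, zpow_sub₀ (by norm_num), List.nil_append, width,
        hu, zpow_natCast]
      · simp
        field_simp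
      · rw [← Subtype.coe_le_coe, coe_branch, coe_branch]
        have := mul_nonneg (width_pos ([] ++ u)).le t.2.1
        simpa using this
      · rw [← Subtype.coe_le_coe, coe_branch, coe_branch]
        have := mul_le_mul_of_nonneg_left t.2.2 (width_pos ([] ++ u)).le
        simpa using this
    obtain ⟨j, hj⟩ := exists_maps_of_affine f ([] ++ u) _ haff
      ((isDyadicPL_act f).map_dyadic (by
        rw [coe_branch]; simpa using isDyadic_start _))
    refine exists_tiles_of_append f j _ fun w hw => ?_
    obtain ⟨v, hv⟩ := hj w hw
    exact ⟨[[] ++ u ++ w], [v], ⟨rfl, rfl⟩, .cons hv .nil⟩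
  have hL' : Tiles 0 L 1 := by simpa using hL
  exact ⟨L, L', hL', hL'.forall_maps hf, hf⟩

/-! ### Binary and ternary trees -/

/-- `L` lists the leaves of a finite binary tree with root `w`. -/
inductive Subdivides : List Bool → List (List Bool) → Prop
  | leaf (w : List Bool) : Subdivides w [w]
  | node {w : List Bool} {L₀ L₁ : List (List Bool)} : Subdivides (w ++ [false]) L₀ →
      Subdivides (w ++ [true]) L₁ → Subdivides w (L₀ ++ L₁)

/-- `L` lists the leaves of a finite tree with root `w`, each of whose inner vertices `u` has the
children `u0`, `u10` and `u11`. -/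
inductive TernarySubdivides : List Bool → List (List Bool) → Prop
  | leaf (w : List Bool) : TernarySubdivides w [w]
  | node {w : List Bool} {L₀ L₁ L₂ : List (List Bool)} : TernarySubdivides (w ++ [false]) L₀ →
      TernarySubdivides (w ++ [true] ++ [false]) L₁ →
      TernarySubdivides (w ++ [true] ++ [true]) L₂ → TernarySubdivides w (L₀ ++ (L₁ ++ L₂))

/-- Dyadic intervals with the same left endpoint are nested. Hence either the first tile is strictly
longer than the interval of `w`, or the tiling has a cut at the right end of `w`. The number `d`
bounds the depth below `w` and drives the induction. -/
lemma Tiles.exists_subdivides (d : ℕ) : ∀ (w : List Bool) (L : List (List Bool)) (b : ℝ),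
    (∀ u ∈ L, u.length ≤ w.length + d) → Tiles (start w) L b → start w + width w ≤ b →
    (∃ u L', L = u :: L' ∧ u.length < w.length) ∨
      ∃ L₁ L₂, L = L₁ ++ L₂ ∧ Subdivides w L₁ ∧ Tiles (start w + width w) L₂ b := by
  induction d with
  | zero =>
    intro w L b hL h hb
    obtain ⟨u, L', rfl⟩ := h.exists_cons (by linarith [width_pos w])
    rcases (hL u (by simp)).lt_or_eq with hu | hu
    · exact .inl ⟨u, L', rfl, hu⟩
    · obtain rfl := eq_of_start_eq hu h.1
      exact .inr ⟨[u], L', rfl, .leaf u, h.2⟩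
  | succ d ih =>
    intro w L b hL h hb
    have hw := width_pos w
    obtain ⟨u, L', rfl⟩ := h.exists_cons (by linarith)
    rcases lt_trichotomy u.length w.length with hu | hu | hu
    · exact .inl ⟨u, L', rfl, hu⟩
    · obtain rfl := eq_of_start_eq hu h.1
      exact .inr ⟨[u], L', rfl, .leaf u, h.2⟩
    · right
      rcases ih (w ++ [false]) (u :: L') b
          (fun v hv => by have := hL v hv; simp only [List.length_append, List.length_singleton]; omega)
          (by rwa [start_append_false])
          (by rw [start_append_false, width_append_singleton]; linarith) with
        ⟨u', L'', he, hu'⟩ | ⟨L₁, L₂, he, h₁, h₂⟩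
      · obtain ⟨rfl, -⟩ := List.cons_eq_cons.1 he
        simp at hu'
        omega
      · rw [start_append_false, width_append_singleton, ← start_append_true] at h₂
        rcases ih (w ++ [true]) L₂ b
            (fun v hv => by
              have := hL v (by rw [he]; simp [hv])
              simp only [List.length_append, List.length_singleton]; omega)
            h₂ (by rw [start_append_true, width_append_singleton]; linarith) with
          ⟨v, L₃, rfl, hv⟩ | ⟨L₃, L₄, rfl, h₃, h₄⟩
        -- A tile that starts at the midpoint of `w` cannot be as long as the interval of `w`.
        · exact absurd h₂.1 (start_append_true_ne (by simp at hv; omega))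
        · refine ⟨L₁ ++ L₃, L₄, by rw [he, List.append_assoc], .node h₁ h₃, ?_⟩
          rw [start_append_true, width_append_singleton] at h₄
          convert h₄ using 1
          ring

lemma Tiles.subdivides {L : List (List Bool)} (h : Tiles 0 L 1) : Subdivides [] L := by
  obtain ⟨d, hd⟩ : ∃ d, ∀ u ∈ L, u.length ≤ d :=
    ⟨(L.map List.length).sum, fun u hu => List.le_sum_of_mem (List.mem_map_of_mem hu)⟩
  rcases Tiles.exists_subdivides d [] L 1 (by simpa using hd) (by simpa using h) (by simp) with
    ⟨u, L', -, hu⟩ | ⟨L₁, L₂, rfl, h₁, h₂⟩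
  · simp at hu
  · cases L₂ with
    | nil => simpa using h₁
    | cons v L₂ =>
      obtain ⟨h2, -⟩ := h₂
      have := start_lt_one v
      simp at h2
      linarith

/-- The leftmost leaf below `w` is `w` followed by zeros. -/
lemma Subdivides.parity_eq {w : List Bool} {L : List (List Bool)} (h : Subdivides w L)
    {p q : Bool} (hL : Alternates p L q) : p = parity w := by
  induction h generalizing q with
  | leaf w => exact hL.1.symm
  | node _ _ h₀ _ =>
    obtain ⟨r, hr, -⟩ := alternates_append.1 hL
    simpa using h₀ hr

/-- A binary subdivision whose leaves have alternating parities is a ternary subdivision of the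
root or of its two children. -/
lemma Subdivides.ternary {w : List Bool} {L : List (List Bool)} (h : Subdivides w L)
    {p q : Bool} (hL : Alternates p L q) : (q ≠ p ∧ TernarySubdivides w L) ∨
      (q = p ∧ ∃ L₀ L₁, L = L₀ ++ L₁ ∧ TernarySubdivides (w ++ [false]) L₀ ∧
        TernarySubdivides (w ++ [true]) L₁) := by
  induction h generalizing p q with
  | leaf w =>
    refine .inl ⟨?_, .leaf w⟩
    have := hL.2
    simp only [Alternates] at this
    simp [← this]
  | @node w L₀ L₁ h₀ h₁ ih₀ ih₁ =>
    obtain ⟨r, hr₀, hr₁⟩ := alternates_append.1 hL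
    have e₀ := h₀.parity_eq hr₀
    have e₁ := h₁.parity_eq hr₁
    rw [parity_append_false] at e₀
    rw [parity_append_true] at e₁
    -- The leaves right of the left child start with parity opposite to `w`, so the left child
    -- cannot be in the second alternative. If the right child is, its two halves complete a ternary
    -- caret at `w`.
    rcases ih₀ hr₀ with ⟨-, t₀⟩ | ⟨e, -⟩
    · rcases ih₁ hr₁ with ⟨e, t₁⟩ | ⟨e, L₂, L₃, rfl, t₂, t₃⟩
      · refine .inr ⟨?_, L₀, L₁, rfl, t₀, t₁⟩
        subst e₀ e₁
        revert e
        cases q <;> cases parity w <;> simp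
      · refine .inl ⟨?_, .node t₀ t₂ t₃⟩
        subst e₀ e₁
        simp [e]
    · subst e₀ e₁
      simp at e

lemma Tiles.exists_ternary {L : List (List Bool)} (h : Tiles 0 L 1)
    (hL : Alternates false L false) : ∃ L₀ L₁, L = L₀ ++ L₁ ∧ TernarySubdivides [false] L₀ ∧
      TernarySubdivides [true] L₁ := by
  rcases h.subdivides.ternary hL with ⟨h, -⟩ | ⟨-, h⟩
  · exact absurd rfl h
  · exact h

/-- Adding a caret wherever needed makes the parities alternate. -/
lemma exists_alternates {R : List Bool → List Bool → Prop}
    (hR : ∀ u v b, R u v → R (u ++ [b]) (v ++ [b])) (hp : ∀ u v, R u v → parity u = parity v)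
    (q : Bool) {L L' : List (List Bool)} (h : List.Forall₂ R L L') {a b a' b' : ℝ}
    (hL : Tiles a L b) (hL' : Tiles a' L' b') :
    ∃ p M M', List.Forall₂ R M M' ∧ Tiles a M b ∧ Tiles a' M' b' ∧
      Alternates p M q ∧ Alternates p M' q := by
  induction h generalizing a a' with
  | nil => exact ⟨q, [], [], .nil, hL, hL', rfl, rfl⟩
  | @cons u v L L' huv _ ih =>
    obtain ⟨p, M, M', hM, h1, h2, h3, h4⟩ := ih hL.2 hL'.2
    have e := hp u v huv
    -- The lists are built from the right. If `u` has the parity `p` with which the tail begins, its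
    -- children have parities `p` and `!p`, which fit in front of the tail.
    by_cases hu : parity u = !p
    · exact ⟨!p, u :: M, v :: M', .cons huv hM, ⟨hL.1, h1⟩, ⟨hL'.1, h2⟩,
        ⟨hu, by simpa using h3⟩, ⟨e ▸ hu, by simpa using h4⟩⟩
    · have hu : parity u = p := by revert hu; cases parity u <;> cases p <;> simp
      have hs : ∀ (u : List Bool) (L : List (List Bool)) (c d : ℝ), start u = c →
          Tiles (c + width u) L d → Tiles c ((u ++ [false]) :: (u ++ [true]) :: L) d := by
        rintro u L c d rfl h
        refine ⟨start_append_false u, ?_, ?_⟩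
        · rw [start_append_true, width_append_singleton]
        · rw [width_append_singleton, width_append_singleton]
          convert h using 1
          ring
      exact ⟨p, _, _, .cons (hR u v false huv) (.cons (hR u v true huv) hM), hs u M _ _ hL.1 h1,
        hs v M' _ _ hL'.1 h2, ⟨by simpa using hu, by simpa using hu, by simpa using h3⟩,
        ⟨by simpa [← e] using hu, by simpa [← e] using hu, by simpa using h4⟩⟩

/-! ### The generators `x i` on words, and their relations -/

/-- The word `1 ⋯ 1` of length `i`. -/
def ones (i : ℕ) : List Bool := List.replicate i true

@[simp] lemma ones_zero : ones 0 = [] := rfl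

@[simp] lemma length_ones (i : ℕ) : (ones i).length = i := List.length_replicate

lemma ones_succ (i : ℕ) : ones (i + 1) = ones i ++ [true] := List.replicate_succ'

lemma ones_succ_cons (i : ℕ) : ones (i + 1) = true :: ones i := rfl

lemma ones_add (i j : ℕ) : ones (i + j) = ones i ++ ones j := List.replicate_add ..

lemma start_ones (i : ℕ) : start (ones i) = 1 - (1 / 2) ^ i := by
  induction i with
  | zero => simp
  | succ i ih => rw [ones_succ_cons, start_cons, ih, pow_succ]; simp; ring

lemma x_succ (i : ℕ) : x (i + 1) = (x 0 ^ i)⁻¹ * x 1 * x 0 ^ i := by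
  simp [x]

lemma coe_act_x_zero (t : unitInterval) : (act (x 0) t : ℝ) =
    if (t : ℝ) ≤ 1 / 4 then 2 * (t : ℝ) else
    if (t : ℝ) ≤ 1 / 2 then (t : ℝ) + 1 / 4 else (t : ℝ) / 2 + 1 / 2 := rfl

lemma coe_act_x_one (t : unitInterval) : (act (x 1) t : ℝ) =
    if (t : ℝ) ≤ 1 / 2 then (t : ℝ) else
    if (t : ℝ) ≤ 5 / 8 then 2 * (t : ℝ) - 1 / 2 else
    if (t : ℝ) ≤ 3 / 4 then (t : ℝ) + 1 / 8 else (t : ℝ) / 2 + 1 / 2 := by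
  have : x 1 = ⟨MulOpposite.op x₁Iso, isDyadicPL_x₁Iso⟩ := by simp [x]
  rw [this]
  rfl

lemma maps_x_zero_false_false : Maps (x 0) [false, false] [false] := maps_iff.2 fun t => by
  have := t.2.1
  have := t.2.2
  rw [coe_act_x_zero, coe_branch]
  simp only [start_cons, width_cons, start_nil, width_nil, Bool.false_eq_true, if_false]
  split_ifs <;> linarith

lemma maps_x_zero_false_true : Maps (x 0) [false, true] [true, false] := maps_iff.2 fun t => by
  have := t.2.1
  have := t.2.2
  rw [coe_act_x_zero, coe_branch]
  simp only [start_cons, width_cons, start_nil, width_nil, Bool.false_eq_true, if_false, if_true]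
  split_ifs <;> linarith

lemma maps_x_zero_true : Maps (x 0) [true] [true, true] := maps_iff.2 fun t => by
  have := t.2.1
  have := t.2.2
  rw [coe_act_x_zero, coe_branch]
  simp only [start_cons, width_cons, start_nil, width_nil, if_true]
  split_ifs <;> linarith

lemma maps_x_one_true_false_false :
    Maps (x 1) [true, false, false] [true, false] := maps_iff.2 fun t => by
  have := t.2.1
  have := t.2.2
  rw [coe_act_x_one, coe_branch]
  simp only [start_cons, width_cons, start_nil, width_nil, Bool.false_eq_true, if_false, if_true]
  split_ifs <;> linarith

lemma maps_x_one_true_false_true :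
    Maps (x 1) [true, false, true] [true, true, false] := maps_iff.2 fun t => by
  have := t.2.1
  have := t.2.2
  rw [coe_act_x_one, coe_branch]
  simp only [start_cons, width_cons, start_nil, width_nil, Bool.false_eq_true, if_false, if_true]
  split_ifs <;> linarith

lemma maps_x_one_true_true :
    Maps (x 1) [true, true] [true, true, true] := maps_iff.2 fun t => by
  have := t.2.1
  have := t.2.2
  rw [coe_act_x_one, coe_branch]
  simp only [start_cons, width_cons, start_nil, width_nil, if_true]
  split_ifs <;> linarith

lemma maps_x_zero_pow (i : ℕ) : Maps (x 0 ^ i) [true] (ones i ++ [true]) := by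
  induction i with
  | zero => exact maps_one _
  | succ i ih =>
    rw [pow_succ']
    have := maps_x_zero_true.mul (ih.append [true])
    rw [ones_succ]
    exact this

/-- `x 0 ^ i` carries the interval of `1` affinely onto that of `1 ⋯ 1` of length `i + 1`, so `x (i
+ 1)` is a copy of `x 1` there. -/
lemma maps_x_succ {i : ℕ} {u v : List Bool} (h : Maps (x 1) (true :: u) (true :: v)) :
    Maps (x (i + 1)) (ones (i + 1) ++ u) (ones (i + 1) ++ v) := by
  rw [x_succ]
  have e : ∀ w : List Bool, ones (i + 1) ++ w = ones i ++ [true] ++ w := fun w => by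
    rw [ones_succ]
  rw [e, e]
  exact (((maps_x_zero_pow i).append u).inv.mul h).mul ((maps_x_zero_pow i).append v)

lemma maps_x_false_false (i : ℕ) :
    Maps (x i) (ones i ++ [false] ++ [false]) (ones i ++ [false]) := by
  cases i with
  | zero => exact maps_x_zero_false_false
  | succ i => rw [List.append_assoc]; exact maps_x_succ maps_x_one_true_false_false

lemma maps_x_false_true (i : ℕ) :
    Maps (x i) (ones i ++ [false] ++ [true]) (ones (i + 1) ++ [false]) := by
  cases i with
  | zero => exact maps_x_zero_false_true
  | succ i =>
    rw [List.append_assoc, ones_succ (i + 1), List.append_assoc]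
    exact maps_x_succ maps_x_one_true_false_true

lemma maps_x_true (i : ℕ) : Maps (x i) (ones (i + 1)) (ones (i + 2)) := by
  cases i with
  | zero => exact maps_x_zero_true
  | succ i =>
    rw [ones_succ (i + 2), ones_succ (i + 1), List.append_assoc]
    exact maps_x_succ maps_x_one_true_true

lemma act_x_eq_self {i : ℕ} {t : unitInterval} (h : (t : ℝ) ≤ start (ones i)) :
    act (x i) t = t := by
  cases i with
  | zero =>
    have : t = 0 := le_antisymm (show (t : ℝ) ≤ 0 by simpa using h) t.2.1
    rw [this]
    exact (act (x 0)).map_bot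
  | succ i =>
    have hs : (act (x 0 ^ i)⁻¹ t : ℝ) ≤ 1 / 2 := by
      by_contra! hc
      have h2 : (⟨1 / 2, by norm_num, by norm_num⟩ : unitInterval) < act (x 0 ^ i)⁻¹ t := hc
      have h3 := (act (x 0 ^ i)).lt_iff_lt.2 h2
      rw [act_act_inv, ← Subtype.coe_lt_coe,
        (maps_x_zero_pow i).act_start (by norm_num [start_cons])] at h3
      rw [ones_succ] at h
      linarith
    have h1 : act (x 1) (act (x 0 ^ i)⁻¹ t) = act (x 0 ^ i)⁻¹ t := by
      apply Subtype.ext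
      rw [coe_act_x_one, if_pos hs]
    rw [x_succ, act_mul, act_mul, h1, act_act_inv]

lemma maps_x_self {i j : ℕ} (h : j < i) : Maps (x i) (ones j ++ [false]) (ones j ++ [false]) := by
  intro t
  apply act_x_eq_self
  rw [coe_branch, start_append_false, width_append_singleton, start_ones, start_ones, width,
    length_ones]
  have h1 : (1 / 2 : ℝ) ^ i ≤ (1 / 2) ^ (j + 1) :=
    pow_le_pow_of_le_one (by norm_num) (by norm_num) h
  have h2 : (0 : ℝ) < (1 / 2) ^ j := by positivity
  have := t.2.2
  rw [pow_succ] at h1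
  nlinarith

lemma x_zero_conj {j : ℕ} (h : 1 ≤ j) : (x 0)⁻¹ * x j * x 0 = x (j + 1) := by
  obtain ⟨j, rfl⟩ := Nat.exists_eq_add_of_le' h
  rw [x_succ j, x_succ (j + 1)]
  group

/-- `x 0` and `x 1` agree on `[3/4, 1]`, and `x j` with `2 ≤ j` is supported there. -/
lemma x_one_conj {j : ℕ} (h : 2 ≤ j) : (x 1)⁻¹ * x j * x 1 = x (j + 1) := by
  rw [← x_zero_conj (by omega : 1 ≤ j)]
  refine conj_eq_of_agree {t | 3 / 4 ≤ (t : ℝ)} (fun t ht => Subtype.ext ?_) fun t ht => ?_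
  · simp only [Set.mem_ofPred_eq] at ht
    rw [coe_act_x_zero, coe_act_x_one]
    split_ifs <;> linarith
  · apply act_x_eq_self
    simp only [Set.mem_ofPred_eq, not_le] at ht
    rw [start_ones]
    have := pow_le_pow_of_le_one (by norm_num : (0 : ℝ) ≤ 1 / 2) (by norm_num) h
    norm_num at this ⊢
    linarith

/-- The defining relations of `F`. Those with positive index `i + 1` are conjugates by `x 0 ^ i` of
the relations for `x 1`. -/
lemma x_conj {i j : ℕ} (h : i < j) : (x i)⁻¹ * x j * x i = x (j + 1) := by
  cases i with
  | zero => exact x_zero_conj h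
  | succ i =>
    have key : ∀ k l : ℕ, x (k + 1 + l) = (x 0 ^ l)⁻¹ * x (k + 1) * x 0 ^ l := by
      intro k l
      rw [show k + 1 + l = (k + l) + 1 by ring, x_succ, x_succ k, pow_add]
      group
    obtain ⟨k, rfl⟩ := Nat.exists_eq_add_of_le h
    have e1 := key (k + 1) i
    have e2 := key (k + 2) i
    have e3 := x_one_conj (show 2 ≤ k + 2 by omega)
    rw [show k + 1 + 1 + i = i + 1 + 1 + k by ring] at e1
    rw [show k + 2 + 1 + i = i + 1 + 1 + k + 1 by ring] at e2
    rw [Nat.succ_eq_add_one, e1, e2, ← e3, x_succ i]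
    group

/-! ### Straightening tilings into right combs -/

/-- The leaves of the tree with `n` carets on the right side below `1 ⋯ 1`. -/
def comb : ℕ → ℕ → List (List Bool)
  | i, 0 => [ones i]
  | i, n + 1 => (ones i ++ [false]) :: comb (i + 1) n

lemma length_comb (i n : ℕ) : (comb i n).length = n + 1 := by
  induction n generalizing i with
  | zero => rfl
  | succ n ih => simp [comb, ih]

lemma comb_add (i n m : ℕ) : comb i (n + m) =
    (List.range n).map (fun j => ones (i + j) ++ [false]) ++ comb (i + n) m := by
  induction n generalizing i with
  | zero => simp
  | succ n ih =>
    rw [show n + 1 + m = n + m + 1 by ring, comb, ih, List.range_succ_eq_map]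
    simp only [List.map_cons, List.map_map, List.cons_append, add_zero]
    congr 3
    · funext j; simp only [Function.comp]; congr 2; omega
    · omega

lemma forall₂_maps_x_comb (i n : ℕ) :
    List.Forall₂ (Maps (x i)) (comb (i + 1) n) (comb (i + 2) n) := by
  have h : ∀ j n, List.Forall₂ (Maps (x i)) (comb (i + 1 + j) n) (comb (i + 2 + j) n) := by
    have hj : ∀ j, Maps (x i) (ones (i + 1 + j)) (ones (i + 2 + j)) := by
      intro j
      rw [ones_add (i + 1), ones_add (i + 2)]
      exact (maps_x_true i).append _
    intro j n
    induction n generalizing j with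
    | zero => exact .cons (hj j) .nil
    | succ n ih => exact .cons ((hj j).append _) (ih (j + 1))
  exact h 0 n

lemma forall₂_maps_x_pre {k i : ℕ} (h : i ≤ k) : List.Forall₂ (Maps (x k))
    ((List.range i).map (fun j => ones (0 + j) ++ [false]))
    ((List.range i).map (fun j => ones (0 + j) ++ [false])) := by
  rw [List.forall₂_same]
  intro u hu
  obtain ⟨j, hj, rfl⟩ := List.mem_map.1 hu
  rw [zero_add]
  exact maps_x_self (by have := List.mem_range.1 hj; omega)

/-- Some element of `Γ` takes the intervals of `L` to those of a right comb. -/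
def Reach (Γ : Subgroup ThompsonF) (L : List (List Bool)) : Prop :=
  ∃ f ∈ Γ, ∃ n, List.Forall₂ (Maps f) L (comb 0 n)

lemma Reach.exists_forall₂ {Γ : Subgroup ThompsonF} {L L' : List (List Bool)} (h : Reach Γ L)
    (h' : Reach Γ L') (hl : L.length = L'.length) : ∃ f ∈ Γ, List.Forall₂ (Maps f) L L' := by
  obtain ⟨f, hf, n, hL⟩ := h
  obtain ⟨g, hg, m, hL'⟩ := h'
  have := hL.length_eq
  have := hL'.length_eq
  rw [length_comb] at *
  obtain rfl : n = m := by omega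
  exact ⟨f * g⁻¹, mul_mem hf (inv_mem hg), forall₂_maps_mul hL (forall₂_maps_inv hL')⟩

lemma forall₂_append_of_length {R : List Bool → List Bool → Prop} {L₁ L₂ M₁ M₂ : List (List Bool)}
    (hl : L₁.length = M₁.length) (h : List.Forall₂ R (L₁ ++ L₂) (M₁ ++ M₂)) :
    List.Forall₂ R L₁ M₁ ∧ List.Forall₂ R L₂ M₂ := by
  induction L₁ generalizing M₁ with
  | nil =>
    obtain rfl := List.length_eq_zero_iff.1 hl.symm
    exact ⟨.nil, h⟩
  | cons u L₁ ih =>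
    cases M₁ with
    | nil => simp at hl
    | cons v M₁ =>
      cases h with
      | cons h1 h2 =>
        obtain ⟨h3, h4⟩ := ih (by simpa using hl) h2
        exact ⟨.cons h1 h3, h4⟩

/-- Locates the tooth of the comb under `w`: an inner tooth `1 ⋯ 10`, or the end `1 ⋯ 1` when
nothing follows `w`. -/
lemma exists_comb_split {f : ThompsonF} {L₁ L₂ : List (List Bool)} {w : List Bool} {n : ℕ}
    (h : List.Forall₂ (Maps f) (L₁ ++ w :: L₂) (comb 0 n)) :
    ∃ i, List.Forall₂ (Maps f) L₁ ((List.range i).map (fun j => ones (0 + j) ++ [false])) ∧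
      ((L₂ = [] ∧ Maps f w (ones i)) ∨ ∃ m, Maps f w (ones i ++ [false]) ∧
        List.Forall₂ (Maps f) L₂ (comb (i + 1) m)) := by
  have hl := h.length_eq
  simp only [length_comb, List.length_append, List.length_cons] at hl
  obtain rfl : n = L₁.length + L₂.length := by omega
  refine ⟨L₁.length, ?_⟩
  rw [comb_add] at h
  obtain ⟨h1, h2⟩ := forall₂_append_of_length (by simp) h
  refine ⟨h1, ?_⟩
  rw [zero_add] at h2
  cases L₂ with
  | nil =>
    cases h2 with
    | cons h3 _ => exact .inl ⟨rfl, h3⟩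
  | cons v L₂ =>
    cases h2 with
    | cons h3 h4 => exact .inr ⟨_, h3, h4⟩

/-- A caret at the end of a comb only lengthens the comb. A caret at the tooth `1 ⋯ 10` with `i`
ones is straightened by `x i`, which fixes the earlier teeth and shifts the later ones. -/
lemma Reach.caret {Γ : Subgroup ThompsonF} (hΓ : ∀ i, x i ∈ Γ) {L₁ L₂ : List (List Bool)}
    {w : List Bool} (h : Reach Γ (L₁ ++ w :: L₂)) :
    Reach Γ (L₁ ++ (w ++ [false]) :: (w ++ [true]) :: L₂) := by
  obtain ⟨f, hf, n, hn⟩ := h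
  obtain ⟨i, h₁, ⟨rfl, h₂⟩ | ⟨m, h₂, h₃⟩⟩ := exists_comb_split hn
  · refine ⟨f, hf, i + 1, ?_⟩
    rw [comb_add, zero_add]
    refine List.rel_append h₁ (.cons (h₂.append _) (.cons ?_ .nil))
    rw [ones_succ]
    exact h₂.append _
  · refine ⟨f * x i, mul_mem hf (hΓ i), i + (m + 2), ?_⟩
    rw [comb_add, zero_add]
    refine List.rel_append (forall₂_maps_mul h₁ (forall₂_maps_x_pre le_rfl))
      (.cons ((h₂.append _).mul (maps_x_false_false i))
        (.cons ((h₂.append _).mul (maps_x_false_true i))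
          (forall₂_maps_mul h₃ (forall₂_maps_x_comb i m))))

/-- A ternary caret at tooth `i` is two binary carets: `x i` straightens the upper one, moving the
lower one to tooth `i + 1`, where `x (i + 1)` finishes. -/
lemma Reach.ternaryCaret {Γ : Subgroup ThompsonF} (hΓ : ∀ i, x i * x (i + 1) ∈ Γ)
    {L₁ L₂ : List (List Bool)} {w : List Bool} (h : Reach Γ (L₁ ++ w :: L₂)) :
    Reach Γ (L₁ ++ (w ++ [false]) :: (w ++ [true] ++ [false]) :: (w ++ [true] ++ [true]) :: L₂) := by
  obtain ⟨f, hf, n, hn⟩ := h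
  obtain ⟨i, h₁, ⟨rfl, h₂⟩ | ⟨m, h₂, h₃⟩⟩ := exists_comb_split hn
  · refine ⟨f, hf, i + 2, ?_⟩
    rw [comb_add, zero_add]
    refine List.rel_append h₁ (.cons (h₂.append _) (.cons ?_ (.cons ?_ .nil)))
    · rw [ones_succ, List.append_assoc, List.append_assoc]
      exact h₂.append _
    · rw [ones_succ, ones_succ, List.append_assoc, List.append_assoc]
      exact h₂.append _
  · refine ⟨f * (x i * x (i + 1)), mul_mem hf (hΓ i), i + (m + 3), ?_⟩
    rw [comb_add, zero_add]
    have e := maps_x_false_true i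
    refine List.rel_append (forall₂_maps_mul h₁ (forall₂_maps_mul (forall₂_maps_x_pre le_rfl)
        (forall₂_maps_x_pre (Nat.le_succ i))))
      (.cons ((h₂.append _).mul ((maps_x_false_false i).mul (maps_x_self (Nat.lt_succ_self i))))
        (.cons (((h₂.append _).append _).mul ((e.append _).mul (maps_x_false_false (i + 1))))
          (.cons (((h₂.append _).append _).mul ((e.append _).mul (maps_x_false_true (i + 1))))
            (forall₂_maps_mul h₃ (forall₂_maps_mul (forall₂_maps_x_comb i m)
              (forall₂_maps_x_comb (i + 1) m))))))

lemma Reach.subdivides {Γ : Subgroup ThompsonF} (hΓ : ∀ i, x i ∈ Γ) {w : List Bool}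
    {L : List (List Bool)} (hL : Subdivides w L) {L₁ L₂ : List (List Bool)}
    (h : Reach Γ (L₁ ++ w :: L₂)) : Reach Γ (L₁ ++ (L ++ L₂)) := by
  induction hL generalizing L₁ L₂ with
  | leaf w => exact h
  | @node w L₃ L₄ _ _ h₃ h₄ =>
    have := h₃ (h.caret hΓ)
    rw [← List.append_assoc] at this
    have := h₄ this
    simpa using this

lemma Reach.ternarySubdivides {Γ : Subgroup ThompsonF} (hΓ : ∀ i, x i * x (i + 1) ∈ Γ)
    {w : List Bool} {L : List (List Bool)} (hL : TernarySubdivides w L)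
    {L₁ L₂ : List (List Bool)} (h : Reach Γ (L₁ ++ w :: L₂)) : Reach Γ (L₁ ++ (L ++ L₂)) := by
  induction hL generalizing L₁ L₂ with
  | leaf w => exact h
  | @node w L₃ L₄ L₅ _ _ _ h₃ h₄ h₅ =>
    have := h₃ (h.ternaryCaret hΓ)
    rw [← List.append_assoc] at this
    have := h₄ this
    rw [← List.append_assoc] at this
    have := h₅ this
    simpa using this

lemma reach_of_tiles {Γ : Subgroup ThompsonF} (hΓ : ∀ i, x i ∈ Γ) {L : List (List Bool)}
    (h : Tiles 0 L 1) : Reach Γ L := by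
  have := Reach.subdivides hΓ h.subdivides (L₁ := []) (L₂ := [])
    ⟨1, one_mem _, 0, .cons (maps_one _) .nil⟩
  simpa using this

lemma reach_of_alternates {Γ : Subgroup ThompsonF} (hΓ : ∀ i, x i * x (i + 1) ∈ Γ)
    {L : List (List Bool)} (h : Tiles 0 L 1) (hL : Alternates false L false) : Reach Γ L := by
  obtain ⟨L₀, L₁, rfl, h₀, h₁⟩ := h.exists_ternary hL
  have h2 : Reach Γ ([] ++ [false] :: [[true]]) :=
    ⟨1, one_mem _, 1, .cons (maps_one _) (.cons (maps_one _) .nil)⟩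
  have h3 := Reach.ternarySubdivides hΓ h₀ h2
  have h4 := Reach.ternarySubdivides hΓ h₁ h3
  simpa using h4

/-! ### Generation of `F` and membership in Jones' subgroup -/

/-- `F` is generated by `x₀` and `x₁`. -/
lemma closure_x_zero_x_one : Subgroup.closure {x 0, x 1} = ⊤ := by
  have h0 : x 0 ∈ Subgroup.closure {x 0, x 1} := Subgroup.subset_closure (by simp)
  have h1 : x 1 ∈ Subgroup.closure {x 0, x 1} := Subgroup.subset_closure (by simp)
  have hx : ∀ i, x i ∈ Subgroup.closure {x 0, x 1} := by
    rintro (_ | i)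
    · exact h0
    · rw [x_succ]
      exact mul_mem (mul_mem (inv_mem (pow_mem h0 i)) h1) (pow_mem h0 i)
  rw [eq_top_iff]
  intro f _
  obtain ⟨L, L', hL, hL', h⟩ := exists_tiles f
  obtain ⟨g, hg, h'⟩ := (reach_of_tiles hx hL).exists_forall₂ (reach_of_tiles hx hL') h.length_eq
  rwa [eq_of_forall₂_maps hL h h']

/-- Conjugation by `x 0 * x 1` raises positive indices by `2`, so `x 1 * x 2` and `x 2 * x 3` yield
all later products. -/
lemma x_mul_x_mem_jones (i : ℕ) : x i * x (i + 1) ∈ jones := by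
  have h0 : x 0 * x 1 ∈ jones := Subgroup.subset_closure (by simp)
  have step : ∀ i, x (i + 1) * x (i + 2) ∈ jones → x (i + 3) * x (i + 4) ∈ jones := by
    intro i h
    have := mul_mem (mul_mem (inv_mem h0) h) h0
    rw [← x_conj (show 1 < i + 2 by omega), ← x_conj (show 1 < i + 3 by omega),
      ← x_conj (show 0 < i + 1 by omega), ← x_conj (show 0 < i + 2 by omega)]
    convert this using 1
    group
  have key : ∀ i, x (i + 1) * x (i + 2) ∈ jones ∧ x (i + 2) * x (i + 3) ∈ jones := by
    intro i
    induction i with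
    | zero => exact ⟨Subgroup.subset_closure (by simp), Subgroup.subset_closure (by simp)⟩
    | succ i ih => exact ⟨ih.2, step i ih.1⟩
  cases i with
  | zero => exact h0
  | succ i => exact (key i).1

/-- An element of `F` that preserves the parities of the digit sums of the words of some dyadic
subdivision lies in Jones' subgroup. -/
lemma mem_jones_of_parity_eq {f : ThompsonF} {L L' : List (List Bool)} (hL : Tiles 0 L 1)
    (h : List.Forall₂ (fun u v => Maps f u v ∧ parity u = parity v) L L') : f ∈ jones := by
  have hL' := hL.forall_maps (h.imp fun _ _ h => h.1)
  obtain ⟨p, M, M', hM, h1, h2, h3, h4⟩ := exists_alternates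
    (fun u v b h => ⟨h.1.append [b], by rw [parity_append, parity_append, h.2]⟩)
    (fun u v h => h.2) false h hL hL'
  obtain rfl : p = false := by
    obtain ⟨u, N, rfl⟩ := h1.exists_cons (by norm_num)
    rw [← h3.1]
    exact parity_eq_false_of_start_eq_zero h1.1
  obtain ⟨g, hg, h'⟩ := (reach_of_alternates x_mul_x_mem_jones h1 h3).exists_forall₂
    (reach_of_alternates x_mul_x_mem_jones h2 h4) hM.length_eq
  rwa [eq_of_forall₂_maps h1 (hM.imp fun _ _ h => h.1) h']

/-! ### Algebra in overgroups of `jones` and in `G` -/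

lemma conj_x_zero_mul_x_one {j : ℕ} (h : 1 ≤ j) :
    (x 0 * x 1)⁻¹ * x j * (x 0 * x 1) = x (j + 2) := by
  rw [← x_conj (show 1 < j + 1 by omega), ← x_conj (show 0 < j by omega)]
  group

/-- Modulo products `x i * x (i + 1)` the given word reduces to `x 1 * x 4`. Conjugations inside `M`
then produce `(x 2)⁻¹ * x 4`, `(x 4)⁻¹ * x 6`, `(x 3)⁻¹ * x 4` and finally `(x 1)⁻¹ * x 2`, which
turns `x 0 * x 1` into `x 0 * x 2`. -/
lemma G_le_of_mem {M : Subgroup ThompsonF} (hM : jones ≤ M)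
    (h : x 1 * x 2 * x 3 * (x 4)⁻¹ * (x 3)⁻¹ * (x 1)⁻¹ ∈ M) : G ≤ M := by
  have a : ∀ i, x i * x (i + 1) ∈ M := fun i => hM (x_mul_x_mem_jones i)
  have h14 : x 1 * x 4 ∈ M := by
    have h2 := mul_mem (inv_mem (a 2)) (mul_mem (inv_mem (mul_mem (inv_mem (a 1)) h)) (a 3))
    have e1 := x_conj (show 1 < 2 by norm_num)
    have e2 := x_conj (show 1 < 3 by norm_num)
    have key : x 2 * x 3 * (x 1 * x 4) = x 1 * x 3 * x 4 * x 4 := by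
      rw [← e2, ← e1]; group
    have key' : x 1 * x 4 = (x 2 * x 3)⁻¹ * (x 1 * x 3 * x 4 * x 4) := by rw [← key]; group
    rw [key']
    convert h2 using 1
    group
  have h24 : (x 2)⁻¹ * x 4 ∈ M := by
    convert mul_mem (inv_mem (a 1)) h14 using 1
    group
  have h46 : (x 4)⁻¹ * x 6 ∈ M := by
    convert mul_mem (mul_mem (inv_mem (a 0)) h24) (a 0) using 1
    rw [← conj_x_zero_mul_x_one (show 1 ≤ 4 by norm_num)]
    nth_rw 1 [← conj_x_zero_mul_x_one (show 1 ≤ 2 by norm_num)]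
    group
  have h34 : (x 3)⁻¹ * x 4 ∈ M := by
    have h2 := mul_mem (mul_mem (mul_mem (mul_mem (inv_mem (a 2)) h24) (a 2)) (inv_mem h46))
      (inv_mem h24)
    convert h2 using 1
    have e1 := x_conj (show 2 < 4 by norm_num)
    have e2 := x_conj (show 3 < 5 by norm_num)
    have e3 := x_conj (show 2 < 3 by norm_num)
    rw [← e2, ← e1, ← e3]
    group
  have h12 : (x 1)⁻¹ * x 2 ∈ M := by
    convert mul_mem (mul_mem (a 0) h34) (inv_mem (a 0)) using 1
    rw [← conj_x_zero_mul_x_one (show 1 ≤ 1 by norm_num),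
      ← conj_x_zero_mul_x_one (show 1 ≤ 2 by norm_num)]
    group
  rw [G, Subgroup.closure_le]
  rintro _ (rfl | rfl)
  · change x 0 * x 2 ∈ M
    convert mul_mem (a 0) h12 using 1
    group
  · exact a 1

lemma x_zero_mul_x_two_mem_G : x 0 * x 2 ∈ G := Subgroup.subset_closure (by simp)

lemma x_one_mul_x_two_mem_G : x 1 * x 2 ∈ G := Subgroup.subset_closure (by simp)

lemma x_one_mul_x_zero_mem_G : x 1 * x 0 ∈ G := by
  convert x_zero_mul_x_two_mem_G using 1
  rw [← x_conj (show 0 < 1 by norm_num)]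
  group

lemma x_one_inv_mul_x_two_mem_G : (x 1)⁻¹ * x 2 ∈ G := by
  -- This is `x 0 * (x 1)⁻¹`. Conjugating `x 1 * x 2` by it gives `x 1 * x 2 * (x 1)⁻¹ * x 2`.
  have hb := mul_mem x_zero_mul_x_two_mem_G (inv_mem x_one_mul_x_two_mem_G)
  convert mul_mem (inv_mem x_one_mul_x_two_mem_G)
    (mul_mem (mul_mem (inv_mem hb) x_one_mul_x_two_mem_G) hb) using 1
  have e1 := x_conj (show 0 < 1 by norm_num)
  have e2 := x_conj (show 0 < 2 by norm_num)
  have e3 := x_conj (show 1 < 2 by norm_num)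
  have e : x 0 * x 1 ^ (-1 : ℤ) = x 0 * x 2 * (x 1 * x 2)⁻¹ := by group
  have key : x 1 * ((x 0)⁻¹ * x 1 * x 0) * ((x 0)⁻¹ * x 2 * x 0) * (x 1)⁻¹ =
      x 1 * x 2 * (x 1)⁻¹ * x 2 := by
    rw [e1, e2, ← e3]; group
  calc (x 1)⁻¹ * x 2 = (x 1 * x 2)⁻¹ * (x 1 * x 2 * (x 1)⁻¹ * x 2) := by group
    _ = _ := by rw [← key, ← e]; group

lemma x_one_mul_x_one_mem_G : x 1 * x 1 ∈ G := by
  convert mul_mem x_one_mul_x_two_mem_G (inv_mem x_one_inv_mul_x_two_mem_G) using 1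
  group

lemma x_zero_mul_x_one_mem_G : x 0 * x 1 ∈ G := by
  convert mul_mem x_zero_mul_x_two_mem_G (inv_mem x_one_inv_mul_x_two_mem_G) using 1
  group

lemma x_zero_mul_x_zero_mem_G : x 0 * x 0 ∈ G := by
  convert mul_mem (mul_mem x_zero_mul_x_one_mem_G (inv_mem x_one_mul_x_one_mem_G))
    x_one_mul_x_zero_mem_G using 1
  group

lemma x_one_mul_x_three_mem_G : x 1 * x 3 ∈ G := by
  have h3 := mul_mem (mul_mem (inv_mem x_zero_mul_x_one_mem_G) x_one_mul_x_one_mem_G)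
    x_zero_mul_x_one_mem_G
  have e := conj_x_zero_mul_x_one le_rfl
  have h33 : x 3 * x 3 ∈ G := by
    convert h3 using 1
    rw [← e]; group
  convert mul_mem (inv_mem x_one_inv_mul_x_two_mem_G) h33 using 1
  nth_rw 2 [← x_conj (show 1 < 2 by norm_num)]
  group

lemma jones_le_G : jones ≤ G := by
  rw [jones, Subgroup.closure_le]
  rintro _ (rfl | rfl | rfl)
  · exact x_zero_mul_x_one_mem_G
  · exact x_one_mul_x_two_mem_G
  · have h21 : x 2 * x 1 ∈ G := by
      convert x_one_mul_x_three_mem_G using 1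
      rw [← x_conj (show 1 < 2 by norm_num)]; group
    change x 2 * x 3 ∈ G
    convert mul_mem (mul_mem h21 (inv_mem x_one_mul_x_one_mem_G)) x_one_mul_x_three_mem_G using 1
    group

/-! ### The index of `G` -/

lemma Maps.length_eq {f : ThompsonF} {u v w : List Bool} (h : Maps f u v) (h' : Maps f u w) :
    v.length = w.length := by
  have h0 := maps_iff.1 h
  have h0' := maps_iff.1 h'
  have e : width v = width w := by
    have e1 := h0 0
    have e2 := h0 1
    rw [h0' 0] at e1
    rw [h0' 1] at e2
    simp at e1 e2
    linarith
  exact pow_right_injective₀ (by norm_num) (by norm_num) e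

lemma maps_x_ones {i j : ℕ} (h : i < j) : Maps (x i) (ones j) (ones (j + 1)) := by
  obtain ⟨k, rfl⟩ := Nat.exists_eq_add_of_le h
  have := (maps_x_true i).append (ones k)
  rw [← ones_add, ← ones_add] at this
  rwa [show i.succ + k + 1 = i + 2 + k by omega]

/-- An element of `G` has slope an even power of `2` at `1`. -/
lemma exists_maps_ones_of_mem_G {f : ThompsonF} (hf : f ∈ G) :
    ∃ n m, Maps f (ones n) (ones m) ∧ n % 2 = m % 2 := by
  induction hf using Subgroup.closure_induction with
  | mem f hf =>
    rcases hf with rfl | rfl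
    · exact ⟨3, 5, (maps_x_ones (by norm_num)).mul (maps_x_ones (by norm_num)), rfl⟩
    · exact ⟨3, 5, (maps_x_ones (by norm_num)).mul (maps_x_ones (by norm_num)), rfl⟩
  | one => exact ⟨0, 0, maps_one _, rfl⟩
  | mul f g _ _ hf hg =>
    obtain ⟨n, m, h, e⟩ := hf
    obtain ⟨n', m', h', e'⟩ := hg
    -- Both maps are restricted to smaller intervals at `1`, so that the target of `f` is the source
    -- of `g`.
    refine ⟨n + n', m' + m, Maps.mul (v := ones (n' + m)) ?_ ?_, by omega⟩
    · rw [add_comm n' m, ones_add, ones_add]; exact h.append _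
    · rw [ones_add, ones_add]; exact h'.append _
  | inv f _ hf =>
    obtain ⟨n, m, h, e⟩ := hf
    exact ⟨m, n, h.inv, e.symm⟩

lemma x_one_notMem_G : x 1 ∉ G := by
  intro h
  obtain ⟨n, m, h, e⟩ := exists_maps_ones_of_mem_G h
  have h1 := h.append (ones 2)
  rw [← ones_add, ← ones_add] at h1
  have := h1.length_eq (maps_x_ones (show 1 < n + 2 by omega))
  simp at this
  omega

/-- The alternative follows the parity of the length of a word for `f` in `x 0`, `x 1` and their
inverses. -/
lemma mem_G_or_mul_x_one_mem_G (f : ThompsonF) : f ∈ G ∨ f * x 1 ∈ G := by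
  have hf : f ∈ Subgroup.closure {x 0, x 1} := by rw [closure_x_zero_x_one]; trivial
  have h10 : (x 1)⁻¹ * x 0 ∈ G := by
    convert mul_mem (inv_mem x_one_mul_x_one_mem_G) x_one_mul_x_zero_mem_G using 1
    group
  induction hf using Subgroup.closure_induction_right with
  | one => exact .inl (one_mem _)
  | mul_right f _ y hy ih =>
    rcases hy with rfl | rfl
    · rcases ih with ih | ih
      · right; convert mul_mem ih x_zero_mul_x_one_mem_G using 1; group
      · left; convert mul_mem ih h10 using 1; group
    · rcases ih with ih | ih
      · right; convert mul_mem ih x_one_mul_x_one_mem_G using 1; group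
      · exact .inl ih
  | mul_inv_cancel f _ y hy ih =>
    rcases hy with rfl | rfl
    · rcases ih with ih | ih
      · right; convert mul_mem ih (inv_mem h10) using 1; group
      · left; convert mul_mem ih (inv_mem x_zero_mul_x_one_mem_G) using 1; group
    · rcases ih with ih | ih
      · right; simpa using ih
      · left; convert mul_mem ih (inv_mem x_one_mul_x_one_mem_G) using 1; group

lemma index_G : G.index = 2 := by
  rw [Subgroup.index_eq_two_iff]
  refine ⟨x 1, fun f => ?_⟩
  rcases mem_G_or_mul_x_one_mem_G f with h | h
  · exact .inr ⟨h, fun h' => x_one_notMem_G ((Subgroup.mul_mem_cancel_left _ h).1 h')⟩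
  · exact .inl ⟨h, fun h' => x_one_notMem_G ((Subgroup.mul_mem_cancel_left _ h').1 h)⟩

/-! ### Parity is preserved by `jones`; infinite index -/

/-- `f` preserves the parity of the digit sum of the dyadic fractions in `[0, 1)`. -/
def PreservesParity (f : ThompsonF) : Prop :=
  ∀ u v, (act f (branch u 0) : ℝ) = start v → parity u = parity v

/-- A dyadic fraction in the tile `w` has an expansion `ws`, and its image has the expansion `w's`,
where `w'` is the image tile. -/
lemma preservesParity_of_tiles {f : ThompsonF} {L L' : List (List Bool)} (hL : Tiles 0 L 1)
    (h : List.Forall₂ (fun u v => Maps f u v ∧ parity u = parity v) L L') :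
    PreservesParity f := by
  intro u v huv
  obtain ⟨w, hw, h1, h2⟩ := hL.exists_mem (start_nonneg u) (start_lt_one u)
  obtain ⟨w', hm, hp⟩ : ∃ w', Maps f w w' ∧ parity w = parity w' := by
    clear hL
    induction h with
    | nil => simp at hw
    | cons h1 _ ih =>
      rcases List.mem_cons.1 hw with rfl | hw
      · exact ⟨_, h1⟩
      · exact ih hw
  have hw0 := width_pos w
  obtain ⟨s, hs⟩ : ∃ s, start s = (start u - start w) / width w := by
    apply IsDyadic.exists_start_eq
    · convert ((isDyadic_start u).add (isDyadic_start w).neg).zpow_mul w.length using 1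
      rw [width, one_div_pow, zpow_natCast]
      field_simp
      ring
    · exact div_nonneg (by linarith) hw0.le
    · rw [div_lt_one hw0]; linarith
  have e : start u = start (w ++ s) := by
    rw [start_append, hs]; field_simp; ring
  have e' : start v = start (w' ++ s) := by
    rw [← huv]
    exact (hm.append s).act_start (by rw [coe_branch, ← e]; simp)
  rw [parity_eq_of_start_eq e, parity_eq_of_start_eq e', parity_append, parity_append, hp]

lemma preservesParity_of_mem_jones {f : ThompsonF} (hf : f ∈ jones) : PreservesParity f := by
  induction hf using Subgroup.closure_induction with
  | mem f hf =>
    have aux : ∀ {L L' : List (List Bool)} {f : ThompsonF}, Tiles 0 L 1 →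
        List.Forall₂ (Maps f) L L' → L.map parity = L'.map parity → PreservesParity f := by
      intro L L' f hL h hp
      refine preservesParity_of_tiles hL (L' := L') ?_
      clear hL
      induction h with
      | nil => exact .nil
      | cons h1 _ ih =>
        simp only [List.map_cons, List.cons.injEq] at hp
        exact .cons ⟨h1, hp.1⟩ (ih hp.2)
    -- These words tile the interval of `1 ⋯ 1` with `i` ones. Source and target digit sums are `i,
    -- i+1, i+2, i+1` and `i, i+1, i+2, i+3`, which agree modulo `2`.
    have q : ∀ i, List.Forall₂ (Maps (x i * x (i + 1)))
        [ones i ++ [false] ++ [false], ones i ++ [false] ++ [true] ++ [false],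
          ones i ++ [false] ++ [true] ++ [true], ones (i + 1)]
        [ones i ++ [false], ones (i + 1) ++ [false], ones (i + 1 + 1) ++ [false],
          ones (i + 1 + 1 + 1)] := fun i =>
      .cons ((maps_x_false_false i).mul (maps_x_self (Nat.lt_succ_self i)))
        (.cons (((maps_x_false_true i).append _).mul (maps_x_false_false (i + 1)))
          (.cons (((maps_x_false_true i).append _).mul (maps_x_false_true (i + 1)))
            (.cons ((maps_x_true i).mul (maps_x_true (i + 1))) .nil)))
    rcases hf with rfl | rfl | rfl
    · refine aux ?_ (q 0) (by decide)
      change Tiles 0 [[false, false], [false, true, false], [false, true, true], [true]] 1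
      norm_num [Tiles, start_cons, width_cons]
    · refine aux ?_ (.cons ((maps_x_self (i := 1) (j := 0) (by norm_num)).mul
        (maps_x_self (by norm_num))) (q 1)) (by decide)
      change Tiles 0 [[false], [true, false, false], [true, false, true, false],
        [true, false, true, true], [true, true]] 1
      norm_num [Tiles, start_cons, width_cons]
    · refine aux ?_ (.cons ((maps_x_self (i := 2) (j := 0) (by norm_num)).mul
        (maps_x_self (by norm_num))) (.cons ((maps_x_self (i := 2) (j := 1) (by norm_num)).mul
        (maps_x_self (by norm_num))) (q 2))) (by decide)
      change Tiles 0 [[false], [true, false], [true, true, false, false],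
        [true, true, false, true, false], [true, true, false, true, true], [true, true, true]] 1
      norm_num [Tiles, start_cons, width_cons]
  | one =>
    intro u v h
    rw [act_one, coe_branch] at h
    exact parity_eq_of_start_eq (by simpa using h)
  | mul f g _ _ hf hg =>
    intro u v h
    have hd : IsDyadic (act f (branch u 0) : ℝ) :=
      (isDyadicPL_act f).map_dyadic (by rw [coe_branch]; simpa using isDyadic_start u)
    have hlt : act f (branch u 0) < 1 := by
      have h1 : act f 1 = 1 := (act f).map_top
      rw [← h1]
      refine (act f).lt_iff_lt.2 ?_
      rw [← Subtype.coe_lt_coe, coe_branch]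
      simpa using start_lt_one u
    obtain ⟨w, hw⟩ := hd.exists_start_eq (act f (branch u 0)).2.1 hlt
    have hb : act f (branch u 0) = branch w 0 :=
      Subtype.ext (by rw [← hw, coe_branch]; simp)
    rw [hf u w hw.symm]
    exact hg w v (by rw [← hb, ← h, act_mul])
  | inv f _ hf =>
    intro u v h
    refine (hf v u ?_).symm
    have : branch v 0 = act f⁻¹ (branch u 0) := Subtype.ext (by rw [h, coe_branch]; simp)
    rw [this, act_act_inv, coe_branch]
    simp

lemma parity_ones (k : ℕ) : parity (ones (2 * k)) = false := by
  induction k with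
  | zero => rfl
  | succ k ih => rw [mul_add, ones_add, parity_append, ih]; rfl

/-- The point `1/4` has digit sum `1`; its image `1 - 2 ^ (-2(k+1))` has digit sum `2(k+1)`. -/
lemma x_zero_pow_notMem_jones (k : ℕ) : x 0 ^ (2 * (k + 1)) ∉ jones := by
  intro h
  have hm : Maps (x 0 ^ (2 * (k + 1))) [false, true] (ones (2 * (k + 1)) ++ [false]) := by
    rw [show 2 * (k + 1) = 2 * k + 1 + 1 by ring, pow_succ', ones_succ]
    exact maps_x_zero_false_true.mul ((maps_x_zero_pow (2 * k + 1)).append [false])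
  have := preservesParity_of_mem_jones h [false, true] _ (hm.act_start (by rw [coe_branch]; simp))
  rw [parity_append_false, parity_ones] at this
  simp [parity] at this

lemma infinite_quotient : Infinite (G ⧸ jones.subgroupOf G) := by
  have hx : ∀ n : ℕ, x 0 ^ (2 * n) ∈ G := fun n => by
    rw [pow_mul, pow_two]; exact pow_mem x_zero_mul_x_zero_mem_G n
  have aux : ∀ n m : ℕ, n < m →
      (QuotientGroup.mk ⟨_, hx n⟩ : G ⧸ jones.subgroupOf G) ≠ QuotientGroup.mk ⟨_, hx m⟩ := by
    intro n m hnm h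
    rw [QuotientGroup.eq, Subgroup.mem_subgroupOf] at h
    obtain ⟨k, rfl⟩ := Nat.exists_eq_add_of_lt hnm
    apply x_zero_pow_notMem_jones k
    change (x 0 ^ (2 * n))⁻¹ * x 0 ^ (2 * (n + k + 1)) ∈ jones at h
    rwa [show 2 * (n + k + 1) = 2 * n + 2 * (k + 1) by ring, pow_add, inv_mul_cancel_left] at h
  refine Infinite.of_injective
    (fun n : ℕ => (QuotientGroup.mk ⟨_, hx n⟩ : G ⧸ jones.subgroupOf G)) fun n m h => ?_
  by_contra hne
  rcases lt_or_gt_of_ne hne with hlt | hlt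
  · exact aux n m hlt h
  · exact aux m n hlt h.symm

/-! ### Transitivity of `jones` on alternating blocks -/

lemma exists_tiles_zero_start (u : List Bool) : ∃ L, Tiles 0 L (start u) := by
  induction u using List.reverseRecOn with
  | nil => exact ⟨[], rfl⟩
  | append_singleton u b ih =>
    obtain ⟨L, hL⟩ := ih
    cases b
    · exact ⟨L, by rwa [start_append_false]⟩
    · refine ⟨L ++ [u ++ [false]], tiles_append.2 ⟨_, hL, start_append_false u, ?_⟩⟩
      rw [width_append_singleton, start_append_true]
      rfl

lemma exists_tiles_end_one (u : List Bool) : ∃ L, Tiles (start u + width u) L 1 := by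
  induction u using List.reverseRecOn with
  | nil => exact ⟨[], by simp [Tiles]⟩
  | append_singleton u b ih =>
    obtain ⟨L, hL⟩ := ih
    cases b
    · refine ⟨(u ++ [true]) :: L, ?_, ?_⟩
      · rw [width_append_singleton, start_append_false, start_append_true]
      · rw [width_append_singleton, start_append_false, width_append_singleton]
        convert hL using 1
        ring
    · refine ⟨L, ?_⟩
      rw [width_append_singleton, start_append_true]
      convert hL using 1
      ring

lemma exists_tiles_alternates {a b : ℝ} {L : List (List Bool)} (h : Tiles a L b) (q : Bool) :
    ∃ p M, Tiles a M b ∧ Alternates p M q := by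
  obtain ⟨p, M, -, -, h1, -, h2, -⟩ := exists_alternates (R := fun u v => u = v)
    (fun u v b h => by rw [h]) (fun u v h => by rw [h]) q (List.forall₂_same.2 fun _ _ => rfl) h h
  exact ⟨p, M, h1, h2⟩

lemma Alternates.parity_eq {a b : ℝ} {p q : Bool} {M : List (List Bool)} (hM : Alternates p M q)
    (h : Tiles a M b) (hab : a < b) {w : List Bool} (hw : start w = a) : p = parity w := by
  obtain ⟨u, M, rfl⟩ := h.exists_cons hab
  rw [← hM.1]
  exact parity_eq_of_start_eq (h.1.trans hw.symm)

lemma Alternates.length_mod_two {p q : Bool} {M : List (List Bool)} (hM : Alternates p M q) :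
    M.length % 2 = if p = q then 0 else 1 := by
  induction M generalizing p with
  | nil => simp only [Alternates] at hM; simp [hM]
  | cons u M ih =>
    have := ih hM.2
    rw [List.length_cons]
    cases p <;> cases q <;> simp at this ⊢ <;> omega

/-- A ternary caret on the first tile adds two tiles and keeps the parities alternating. -/
lemma Tiles.exists_longer {a b : ℝ} {p q : Bool} {M : List (List Bool)} (h : Tiles a M b)
    (hM : Alternates p M q) (hab : a < b) (k : ℕ) :
    ∃ M', M'.length = M.length + 2 * k ∧ Tiles a M' b ∧ Alternates p M' q := by
  induction k with
  | zero => exact ⟨M, rfl, h, hM⟩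
  | succ k ih =>
    obtain ⟨M', hl, h', hM'⟩ := ih
    obtain ⟨u, N, rfl⟩ := h'.exists_cons hab
    refine ⟨(u ++ [false]) :: (u ++ [true] ++ [false]) :: (u ++ [true] ++ [true]) :: N, ?_, ?_, ?_⟩
    · simp at hl ⊢; omega
    · refine ⟨by rw [start_append_false, h'.1], ?_, ?_, ?_⟩
      · rw [start_append_false, start_append_true, width_append_singleton, h'.1]
      · simp only [start_append_true, width_append_singleton, h'.1]
      · simp only [width_append_singleton]
        convert h'.2 using 1
        ring
    · have := hM'.1
      exact ⟨by simpa using this, by simp [parity_append, parity, this],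
        by simp [parity_append, parity, this], by simpa using hM'.2⟩

lemma exists_same_length {a b a' b' : ℝ} {p q : Bool} {M N : List (List Bool)} (h : Tiles a M b)
    (hM : Alternates p M q) (hab : a < b) (h' : Tiles a' N b') (hN : Alternates p N q)
    (hab' : a' < b') : ∃ M' N', M'.length = N'.length ∧ Tiles a M' b ∧ Alternates p M' q ∧
      Tiles a' N' b' ∧ Alternates p N' q := by
  have e1 := hM.length_mod_two
  have e2 := hN.length_mod_two
  -- The lengths of `M` and `N` have the same parity, so adding to each the other's length rounded
  -- down to an even number makes them equal.
  obtain ⟨M', l1, h1, h2⟩ := h.exists_longer hM hab (N.length / 2)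
  obtain ⟨N', l2, h3, h4⟩ := h'.exists_longer hN hab' (M.length / 2)
  exact ⟨M', N', by omega, h1, h2, h3, h4⟩

/-- Jones' subgroup acts transitively on the blocks of consecutive dyadic intervals whose words
have alternating parities, as long as the blocks do not touch the ends of `[0, 1]`. -/
lemma exists_mem_jones_forall₂_maps {u w u' w' : List Bool} {B B' : List (List Bool)} {q : Bool}
    (hu : 0 < start u) (hu' : 0 < start u')
    (hw : parity w = q) (hw' : parity w' = q)
    (hB : Tiles (start u) B (start w)) (hBa : Alternates (parity u) B q)
    (hB' : Tiles (start u') B' (start w')) (hBa' : Alternates (parity u) B' q)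
    (hl : B.length = B'.length) : ∃ f ∈ jones, List.Forall₂ (Maps f) B B' := by
  -- The complements of the blocks receive alternating tilings that fit onto the blocks. With equal
  -- lengths on each side, an element matching the full tilings matches the blocks.
  have left : ∀ v, 0 < start v → ∃ M, Tiles 0 M (start v) ∧ Alternates false M (parity u) := by
    intro v hv
    obtain ⟨L, hL⟩ := exists_tiles_zero_start v
    obtain ⟨p, M, h1, h2⟩ := exists_tiles_alternates hL (parity u)
    obtain rfl : p = false := h2.parity_eq h1 hv (w := []) start_nil
    exact ⟨M, h1, h2⟩
  have right : ∀ v, parity v = q → ∃ M, Tiles (start v) M 1 ∧ Alternates q M false := by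
    intro v hv
    obtain ⟨L, hL⟩ := exists_tiles_end_one v
    obtain ⟨p, M, h1, h2⟩ := exists_tiles_alternates (L := v :: L) ⟨rfl, hL⟩ false
    obtain rfl : p = q := (h2.parity_eq h1 (start_lt_one v) (w := v) rfl).trans hv
    exact ⟨M, h1, h2⟩
  obtain ⟨M₁, m1, m2⟩ := left u hu
  obtain ⟨N₁, n1, n2⟩ := left u' hu'
  obtain ⟨M₂, m3, m4⟩ := right w hw
  obtain ⟨N₂, n3, n4⟩ := right w' hw'
  obtain ⟨M₁, N₁, l1, m1, m2, n1, n2⟩ := exists_same_length m1 m2 hu n1 n2 hu'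
  obtain ⟨M₂, N₂, l2, m3, m4, n3, n4⟩ :=
    exists_same_length m3 m4 (start_lt_one w) n3 n4 (start_lt_one w')
  have r1 : Reach jones (M₁ ++ (B ++ M₂)) := reach_of_alternates x_mul_x_mem_jones
    (tiles_append.2 ⟨_, m1, tiles_append.2 ⟨_, hB, m3⟩⟩)
    (alternates_append.2 ⟨_, m2, alternates_append.2 ⟨_, hBa, m4⟩⟩)
  have r2 : Reach jones (N₁ ++ (B' ++ N₂)) := reach_of_alternates x_mul_x_mem_jones
    (tiles_append.2 ⟨_, n1, tiles_append.2 ⟨_, hB', n3⟩⟩)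
    (alternates_append.2 ⟨_, n2, alternates_append.2 ⟨_, hBa', n4⟩⟩)
  obtain ⟨f, hf, h⟩ := r1.exists_forall₂ r2 (by simp [l1, l2, hl])
  exact ⟨f, hf, (forall₂_append_of_length hl (forall₂_append_of_length l1 h).2).1⟩

/-! ### Overgroups of `jones` contain `G` -/

/-- The conjugate by `x₀` of an element of Jones' subgroup supported in `[3/8, 3/4]` lies in every
overgroup that contains an element agreeing with `x₀` on `[3/8, 3/4]`. -/
lemma conj_mem_of_maps {M : Subgroup ThompsonF} (hM : jones ≤ M) {g : ThompsonF} (hg : g ∈ M)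
    (h₁ : Maps g [false, true, true] [true, false, true])
    (h₂ : Maps g [true, false] [true, true, false]) :
    x 1 * x 2 * x 3 * (x 4)⁻¹ * (x 3)⁻¹ * (x 1)⁻¹ ∈ M := by
  set h := x 0 * x 1 * (x 2 * x 3) * (x 3 * x 4)⁻¹ * (x 0 * x 1)⁻¹ with hh
  have a : ∀ i, x i * x (i + 1) ∈ jones := x_mul_x_mem_jones
  have hmem : h ∈ jones := mul_mem (mul_mem (mul_mem (a 0) (a 2)) (inv_mem (a 3))) (inv_mem (a 0))
  have key : (x 0)⁻¹ * h * x 0 = g⁻¹ * h * g := by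
    refine (conj_eq_of_agree
      {t | ∃ s, t = branch [false, true, true] s ∨ t = branch [true, false] s} ?_ ?_).symm
    · rintro _ ⟨s, rfl | rfl⟩
      · exact (h₁ s).trans (maps_x_zero_false_true.append [true] s).symm
      · exact (h₂ s).trans (maps_x_zero_true.append [false] s).symm
    · intro t ht
      -- `x 0 * x 1` takes `[3/8, 3/4]` onto `[3/4, 15/16]`. It remains to see that the middle
      -- factor of `h` fixes `0`, `10` and `1111`, the tiles of the complement.
      have c : ∀ {u v : List Bool}, Maps (x 0 * x 1) u v → Maps (x 2 * x 3 * (x 3 * x 4)⁻¹) v v →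
          Maps h u u := fun h1 h2 => by
        rw [hh, mul_assoc (x 0 * x 1)]
        exact (h1.mul h2).mul h1.inv
      have fix : ∀ {j}, j < 2 → Maps (x 2 * x 3 * (x 3 * x 4)⁻¹) (ones j ++ [false])
          (ones j ++ [false]) := fun hj =>
        ((maps_x_self hj).mul (maps_x_self (by omega))).mul
          ((maps_x_self (by omega)).mul (maps_x_self (by omega))).inv
      have c1 : Maps h [false, false] [false, false] :=
        c (maps_x_zero_false_false.mul (maps_x_self (j := 0) (by norm_num))) (fix (j := 0) (by norm_num))
      have c2 : Maps h [false, true, false] [false, true, false] :=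
        c ((maps_x_zero_false_true.append [false]).mul maps_x_one_true_false_false)
          (fix (j := 1) (by norm_num))
      have o : ∀ {i j}, i < j → Maps (x i) (ones j) (ones (j + 1)) := maps_x_ones
      have c3 : Maps h [true, true] [true, true] :=
        c (v := ones 4) ((o (j := 2) (by norm_num)).mul (o (by norm_num)))
          (((o (by norm_num)).mul (o (by norm_num))).mul
            ((o (i := 3) (j := 4) (by norm_num)).mul (o (by norm_num))).inv)
      have hT : Tiles 0 [[false, false], [false, true, false], [false, true, true], [true, false],
          [true, true]] 1 := by
        norm_num [Tiles, start_cons, width_cons]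
      obtain ⟨u, hu, s, rfl⟩ := hT.exists_mem_one t
      simp only [List.mem_cons, List.not_mem_nil, or_false] at hu
      rcases hu with rfl | rfl | rfl | rfl | rfl
      · exact c1 s
      · exact c2 s
      · exact absurd ⟨s, .inl rfl⟩ ht
      · exact absurd ⟨s, .inr rfl⟩ ht
      · exact c3 s
  have : (x 0)⁻¹ * h * x 0 ∈ M := by
    rw [key]
    exact mul_mem (mul_mem (inv_mem hg) (hM hmem)) hg
  convert this using 1
  rw [hh]
  group

/-- The block `u₁`, `u₂0` has parities even, odd like `011`, `10`, so `jones` matches these. On the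
target side `v₁` and `v₂0` are both even; splitting `v₁` restores alternation and allows a match
with `1010`, `1011`, `110`. Using only left halves of `u₂` and `v₂` keeps the blocks away from `1`.
-/
lemma exists_maps_of_parity {M : Subgroup ThompsonF} (hM : jones ≤ M) {f : ThompsonF} (hf : f ∈ M)
    {u₁ u₂ v₁ v₂ : List Bool} (h₁ : Maps f u₁ v₁) (h₂ : Maps f u₂ v₂)
    (hu : start u₂ = start u₁ + width u₁) (hv : start v₂ = start v₁ + width v₁)
    (hu0 : 0 < start u₁) (hv0 : 0 < start v₁) (pu₁ : parity u₁ = false) (pv₁ : parity v₁ = false)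
    (pu₂ : parity u₂ = true) (pv₂ : parity v₂ = false) :
    ∃ g ∈ M, Maps g [false, true, true] [true, false, true] ∧
      Maps g [true, false] [true, true, false] := by
  obtain ⟨e, he, h⟩ := exists_mem_jones_forall₂_maps (u := u₁) (w := u₂ ++ [true])
    (u' := [false, true, true]) (w' := [true, true]) (B := [u₁, u₂ ++ [false]])
    (B' := [[false, true, true], [true, false]]) (q := false)
    hu0 (by norm_num [start_cons]) (by simp [pu₂]) rfl
    (by simp [Tiles, start_append_false, start_append_true, width_append_singleton, hu])
    (by simp [Alternates, pu₁, pu₂])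
    (by norm_num [Tiles, start_cons, width_cons]) (by simp [Alternates, pu₁, parity]) rfl
  obtain ⟨e', he', h'⟩ := exists_mem_jones_forall₂_maps (u := v₁ ++ [false]) (w := v₂ ++ [true])
    (u' := [true, false, true, false]) (w' := [true, true, true])
    (B := [v₁ ++ [false], v₁ ++ [true], v₂ ++ [false]])
    (B' := [[true, false, true, false], [true, false, true, true], [true, true, false]]) (q := true)
    (by rwa [start_append_false]) (by norm_num [start_cons]) (by simp [pv₂]) rfl
    (by
      simp only [Tiles, start_append_false, start_append_true, width_append_singleton, hv]
      refine ⟨trivial, trivial, ?_, ?_⟩ <;> ring)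
    (by simp [Alternates, pv₁, pv₂])
    (by norm_num [Tiles, start_cons, width_cons]) (by simp [Alternates, pv₁, parity]) rfl
  simp only [List.forall₂_cons] at h h'
  refine ⟨e⁻¹ * f * e', mul_mem (mul_mem (inv_mem (hM he)) hf) (hM he'),
    (h.1.inv.mul h₁).mul (Maps.merge h'.1 h'.2.1),
    (h.2.1.inv.mul (h₂.append [false])).mul h'.2.2.1⟩

/-- Takes the first pair at which `P` fails, together with its predecessor. -/
lemma exists_adjacent {R P : List Bool → List Bool → Prop} {L L' : List (List Bool)}
    (h : List.Forall₂ R L L') {u v : List Bool} (huv : R u v) (hP : P u v)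
    (hn : ¬List.Forall₂ P L L') {a b a' b' : ℝ} (hL : Tiles a (u :: L) b)
    (hL' : Tiles a' (v :: L') b') : ∃ u₁ u₂ v₁ v₂, R u₁ v₁ ∧ R u₂ v₂ ∧ P u₁ v₁ ∧ ¬P u₂ v₂ ∧
      start u₂ = start u₁ + width u₁ ∧ start v₂ = start v₁ + width v₁ := by
  induction h generalizing u v a a' with
  | nil => exact absurd .nil hn
  | @cons u' v' L L' h1 _ ih =>
    by_cases hP' : P u' v'
    · exact ih h1 hP' (fun h => hn (.cons hP' h)) hL.2 hL'.2
    · exact ⟨u, u', v, v', huv, h1, hP, hP', by rw [hL.1, hL.2.1], by rw [hL'.1, hL'.2.1]⟩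

/-- Appending one or two digits `1` makes the parity even, moves the left endpoint off `0`, and
keeps the right endpoint, so adjacency to the next tile survives. -/
lemma exists_refine (u v : List Bool) (h : parity u = parity v) :
    ∃ s, parity (u ++ s) = false ∧ parity (v ++ s) = false ∧
      ∀ w : List Bool, 0 < start (w ++ s) ∧ start (w ++ s) + width (w ++ s) = start w + width w := by
  have key : ∀ k, ∀ w : List Bool, 0 < start (w ++ ones (k + 1)) ∧
      start (w ++ ones (k + 1)) + width (w ++ ones (k + 1)) = start w + width w := by
    intro k w
    have := width_pos w
    have := start_nonneg w
    have hp : (1 / 2 : ℝ) ^ (k + 1) < 1 := pow_lt_one₀ (by norm_num) (by norm_num) (by omega)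
    have e : width (ones (k + 1)) = (1 / 2) ^ (k + 1) := by rw [width, length_ones]
    rw [start_append, width_append, start_ones, e]
    constructor
    · nlinarith
    · ring
  by_cases hu : parity u = true
  · refine ⟨ones 1, ?_, ?_, key 0⟩
    · simp [parity_append, hu, ones, parity]
    · simp [parity_append, ← h, hu, ones, parity]
  · refine ⟨ones 2, ?_, ?_, key 1⟩
    · simp [parity_append, hu, ones, parity]
    · simp [parity_append, ← h, hu, ones, parity]

lemma G_le_of_notMem_jones {M : Subgroup ThompsonF} (hM : jones ≤ M) {f : ThompsonF} (hf : f ∈ M)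
    (hfj : f ∉ jones) : G ≤ M := by
  obtain ⟨L, L', hL, hL', h⟩ := exists_tiles f
  have hn : ¬List.Forall₂ (fun u v => Maps f u v ∧ parity u = parity v) L L' :=
    fun h => hfj (mem_jones_of_parity_eq hL h)
  obtain ⟨u, N, rfl⟩ := hL.exists_cons (by norm_num)
  obtain ⟨v, N', rfl⟩ := hL'.exists_cons (by norm_num)
  rw [List.forall₂_cons] at h
  have hp : parity u = parity v := by
    rw [parity_eq_false_of_start_eq_zero hL.1, parity_eq_false_of_start_eq_zero hL'.1]
  obtain ⟨u₁, u₂, v₁, v₂, h₁, h₂, ⟨-, p₁⟩, p₂, hu, hv⟩ := exists_adjacent h.2 h.1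
    (P := fun u v => Maps f u v ∧ parity u = parity v) ⟨h.1, hp⟩
    (fun h' => hn (.cons ⟨h.1, hp⟩ h')) hL hL'
  have p₂ : parity u₂ ≠ parity v₂ := fun h => p₂ ⟨h₂, h⟩
  obtain ⟨s, ps, ps', hs⟩ := exists_refine u₁ v₁ p₁
  rw [← (hs u₁).2] at hu
  rw [← (hs v₁).2] at hv
  obtain ⟨g, hg, g₁, g₂⟩ : ∃ g ∈ M, Maps g [false, true, true] [true, false, true] ∧
      Maps g [true, false] [true, true, false] := by
    -- If the bad tile goes from even to odd, `f` is replaced by its inverse.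
    cases hq : parity u₂
    · exact exists_maps_of_parity hM (inv_mem hf) (h₁.append s).inv h₂.inv hv hu (hs v₁).1
        (hs u₁).1 ps' ps (by rw [hq] at p₂; simpa using p₂.symm) hq
    · exact exists_maps_of_parity hM hf (h₁.append s) h₂ hu hv (hs u₁).1 (hs v₁).1 ps ps' hq
        (by rw [hq] at p₂; simpa using p₂.symm)
  exact G_le_of_mem hM (conj_mem_of_maps hM hg g₁ g₂)

/-! ### The lattice of overgroups -/

lemma eq_G_or_eq_top {M : Subgroup ThompsonF} (h : G ≤ M) : M = G ∨ M = ⊤ := by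
  by_cases h1 : x 1 ∈ M
  · right
    rw [eq_top_iff]
    intro f _
    rcases mem_G_or_mul_x_one_mem_G f with hf | hf
    · exact h hf
    · exact (Subgroup.mul_mem_cancel_right _ h1).1 (h hf)
  · left
    refine le_antisymm (fun f hf => ?_) h
    rcases mem_G_or_mul_x_one_mem_G f with hf' | hf'
    · exact hf'
    · exact absurd ((Subgroup.mul_mem_cancel_left _ hf).1 (h hf')) h1

lemma jones_le_iff {M : Subgroup ThompsonF} : jones ≤ M ↔ M = jones ∨ M = G ∨ M = ⊤ := by
  constructor
  · intro hM
    by_cases h : M ≤ jones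
    · exact .inl (le_antisymm h hM)
    · obtain ⟨f, hf, hfj⟩ := SetLike.not_le_iff_exists.1 h
      exact .inr (eq_G_or_eq_top (G_le_of_notMem_jones hM hf hfj))
  · rintro (rfl | rfl | rfl)
    · exact le_rfl
    · exact jones_le_G
    · exact le_top

lemma G_not_le_jones : ¬G ≤ jones := fun h =>
  x_zero_pow_notMem_jones 0 (by simpa [pow_two] using h x_zero_mul_x_zero_mem_G)

lemma G_ne_top : G ≠ ⊤ := fun h => x_one_notMem_G (h ▸ Subgroup.mem_top _)

lemma isCoatom_jones : IsCoatom (jones.subgroupOf G) := by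
  refine ⟨fun h => G_not_le_jones (Subgroup.subgroupOf_eq_top.1 h), fun K hK => ?_⟩
  have hj : jones ≤ K.map G.subtype := by
    rw [← Subgroup.map_subgroupOf_eq_of_le jones_le_G]
    exact Subgroup.map_mono hK.le
  have hKG : K.map G.subtype ≤ G := Subgroup.map_subtype_le K
  have hK' : K = (K.map G.subtype).subgroupOf G :=
    (Subgroup.comap_map_eq_self_of_injective G.subtype_injective K).symm
  rcases jones_le_iff.1 hj with h | h | h
  · rw [hK', h] at hK
    exact absurd hK (lt_irrefl _)
  · rw [hK', h, Subgroup.subgroupOf_self]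
  · rw [h] at hKG
    exact absurd (top_le_iff.1 hKG) G_ne_top

end ThompsonF

theorem corollary3p10 :
    ThompsonF.G.index = 2 ∧
    ThompsonF.jones ≤ ThompsonF.G ∧
    IsCoatom (ThompsonF.jones.subgroupOf ThompsonF.G) ∧
    Infinite (ThompsonF.G ⧸ ThompsonF.jones.subgroupOf ThompsonF.G) ∧
    {H : Subgroup ThompsonF | ThompsonF.jones ≤ H} =
      {ThompsonF.jones, ThompsonF.G, ⊤} ∧
    {H : Subgroup ThompsonF | ThompsonF.jones ≤ H}.ncard = 3 := by
  have h : {H : Subgroup ThompsonF | ThompsonF.jones ≤ H} =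
      {ThompsonF.jones, ThompsonF.G, ⊤} := Set.ext fun _ => ThompsonF.jones_le_iff
  refine ⟨ThompsonF.index_G, ThompsonF.jones_le_G, ThompsonF.isCoatom_jones,
    ThompsonF.infinite_quotient, h, ?_⟩
  rw [h, Set.ncard_eq_three]
  exact ⟨_, _, _, fun e => ThompsonF.G_not_le_jones e.ge,
    fun e => ThompsonF.G_not_le_jones (e ▸ le_top), ThompsonF.G_ne_top, rfl⟩
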